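/- Let $b\in\mathbb R$ and let $\mu\in L^1(\mathbb R)$ with $\mu\ge 0$ almost everywhere; put $\nu:=\int_{\mathbb R}\mu$. For $g\ge 0$ let $$F(b,g):=\pi g^2+\frac{b^2}{4\pi}\Big\{\frac{2\pi g}{b}\Big\}\Big(1-\Big\{\frac{2\pi g}{b}\Big\}\Big)\quad (b\neq 0),\qquad F(0,g):=\pi g^2,$$ where $\{x\}$ denotes the fractional part of $x$. Let $\mathcal G^\nu$ be the set of trace class self-adjoint operators $G\ge 0$ on $L^2(\mathbb R;\mathbb C)$ with $\mathrm{Tr}(G)=\nu$; let $\rho_G\in L^1(\mathbb R)$ be the density of $G$, i.e. $\rho_G(x)=G(x,x)=\sum_i |(G^{1/2}e_i)(x)|^2$ for any orthonormal basis $(e_i)$ of $L^2(\mathbb R)$, and let $\mathrm{Tr}(-\Delta G):=\sum_i \|(G^{1/2}e_i)'\|_{L^2}^2\in[0,\infty]$ (a term is $+\infty$ if $G^{1/2}e_i\notin H^1(\mathbb R)$). For $f\in L^1(\mathbb R)$ put $W_f(x):=\int_{-\infty}^x f$ and $\mathcal D_1(f):=4\pi\int_{\mathbb R}|W_f|^2\in[0,\infty]$.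 For $G\in\mathcal G^\nu$ define the reduced Hartree--Fock energy $$\mathcal E_b^{\rm rHF}(G):=\tfrac12\mathrm{Tr}(-\Delta G)+\mathrm{Tr}(F(b,G))+\tfrac12\mathcal D_1(\rho_G-\mu)\in[0,\infty],$$ where $F(b,G)$ is defined by functional calculus, and let $\mathcal I_b^{\rm rHF}:=\inf\{\mathcal E_b^{\rm rHF}(G):\ G\in\mathcal G^\nu\}$. Theorem. The infimum $\mathcal I_b^{\rm rHF}$ is finite and is attained: there is $G_*\in\mathcal G^\nu$ with $\mathcal E_b^{\rm rHF}(G_*)=\mathcal I_b^{\rm rHF}$. Moreover all minimizers share the same density: if $G_1,G_2\in\mathcal G^\nu$ are two minimizers, then $\rho_{G_1}=\rho_{G_2}$ almost everywhere. -/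

import Mathlib

open MeasureTheory FourierTransform
open scoped ENNReal

noncomputable section

namespace RHF

/-- The one-particle space `L²(ℝ; ℂ)`. -/
abbrev L2 : Type := Lp ℂ 2 (volume : Measure ℝ)

/-- Bounded linear operators on `L²(ℝ; ℂ)`. -/
abbrev Op : Type := L2 →L[ℂ] L2

/-- The positive square root `G^{1/2}` of a positive operator. -/
def sqrtOp {H : Type*} [NormedAddCommGroup H] [InnerProductSpace ℂ H] [CompleteSpace H]
    (G : H →L[ℂ] H) : H →L[ℂ] H := CFC.sqrt G

/-- `f(G)` for a self-adjoint operator `G` and a continuous function `f`, by the continuous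
functional calculus. -/
def funOp {H : Type*} [NormedAddCommGroup H] [InnerProductSpace ℂ H] [CompleteSpace H]
    (f : ℝ → ℝ) (G : H →L[ℂ] H) : H →L[ℂ] H := cfc f G

/-! ### Trace, kinetic energy and density of a positive operator

These are written with a Hilbert basis; the lemmas `traceIn_eq`, `kineticIn_eq`, `densityIn_ae_eq`
below show that the basis does not matter. -/

/-- `Tr T = ∑ᵢ ⟨eᵢ, T eᵢ⟩ ∈ [0, ∞]` of a positive operator, computed in the basis `e`. -/
def traceIn {ι : Type*} (e : HilbertBasis ι ℂ L2) (T : Op) : ℝ≥0∞ :=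
  ∑' i, ENNReal.ofReal (RCLike.re (inner ℂ (e i) (T (e i))))

/-- The closed quadratic form `⟨u, -Δ u⟩ = ‖u'‖² ∈ [0, ∞]` of the operator `-Δ = -d²/dx²` on `L²(ℝ)`
(it is `∞` exactly when `u ∉ H¹(ℝ)`). Mathlib's Fourier transform has the phase `exp(-2πi x ξ)`,
so `-Δ` is the multiplication by `(2πξ)²`. -/
def laplaceForm (u : L2) : ℝ≥0∞ :=
  ∫⁻ ξ : ℝ, ENNReal.ofReal ((2 * Real.pi * ξ) ^ 2) * ‖(𝓕 u : L2) ξ‖ₑ ^ 2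

/-- `Tr(-Δ G) = Tr(G^{1/2} (-Δ) G^{1/2}) = ∑ᵢ ⟨G^{1/2} eᵢ, -Δ G^{1/2} eᵢ⟩ ∈ [0, ∞]` for `G ≥ 0`,
computed in the basis `e`. -/
def kineticIn {ι : Type*} (e : HilbertBasis ι ℂ L2) (G : Op) : ℝ≥0∞ :=
  ∑' i, laplaceForm (sqrtOp G (e i))

/-- The density `ρ_G(x) = G(x, x) = ∑ᵢ |(G^{1/2} eᵢ)(x)|² ∈ [0, ∞]` for `G ≥ 0`,
computed in the basis `e`. -/
def densityIn {ι : Type*} (e : HilbertBasis ι ℂ L2) (G : Op) (x : ℝ) : ℝ≥0∞ :=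
  ∑' i, ‖(sqrtOp G (e i) : L2) x‖ₑ ^ 2

/-- Index set of a fixed Hilbert basis of `L²(ℝ)`. -/
def basisIndex : Set L2 := (exists_hilbertBasis ℂ L2).choose

/-- A fixed Hilbert basis of `L²(ℝ)`. -/
def basis : HilbertBasis basisIndex ℂ L2 := (exists_hilbertBasis ℂ L2).choose_spec.choose

/-- `Tr T ∈ [0, ∞]` for a positive operator `T`. -/
def trace (T : Op) : ℝ≥0∞ := traceIn basis T

/-- `Tr(-Δ G) ∈ [0, ∞]` for a positive operator `G`. -/
def traceLaplace (G : Op) : ℝ≥0∞ := kineticIn basis G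

/-- The density `ρ_G : ℝ → ℝ` of a positive trace class operator `G`. -/
def density (G : Op) (x : ℝ) : ℝ := (densityIn basis G x).toReal

/-! ### The energy -/

/-- `F(b, g) = π g² + (b² / 4π) {2πg/b} (1 - {2πg/b})`, where `{·}` is the fractional part.
For `b = 0` the second term vanishes because of the factor `b²`, so that `F(0, g) = π g²`. -/
def F (b g : ℝ) : ℝ :=
  Real.pi * g ^ 2 + b ^ 2 / (4 * Real.pi) *
    (Int.fract (2 * Real.pi * g / b) * (1 - Int.fract (2 * Real.pi * g / b)))

/-- `F(b, G)`, in the sense of functional calculus. -/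
def FOp (b : ℝ) (G : Op) : Op := funOp (F b) G

/-- The primitive `W_f(x) = ∫_{-∞}^x f` of an integrable function. -/
def primitive (f : ℝ → ℝ) (x : ℝ) : ℝ := ∫ y in Set.Iic x, f y

/-- The one-dimensional Hartree term `D₁(f) = 4π ∫ |W_f|² ∈ [0, ∞]` of `f ∈ L¹(ℝ)`.
It is finite if and only if `W_f ∈ L²(ℝ)`. -/
def hartree (f : ℝ → ℝ) : ℝ≥0∞ :=
  ENNReal.ofReal (4 * Real.pi) * ∫⁻ x : ℝ, ‖primitive f x‖ₑ ^ 2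

/-- The reduced states with trace `ν`: positive (hence self-adjoint) operators on `L²(ℝ)` with
`Tr G = ν`; since `ν` is finite, they are trace class. -/
def states (ν : ℝ) : Set Op := {G | G.IsPositive ∧ trace G = ENNReal.ofReal ν}

/-- The reduced Hartree-Fock energy
`½ Tr(-Δ G) + Tr F(b, G) + ½ D₁(ρ_G - μ) ∈ [0, ∞]`. -/
def energy (b : ℝ) (μ : ℝ → ℝ) (G : Op) : ℝ≥0∞ :=
  2⁻¹ * traceLaplace G + trace (FOp b G) + 2⁻¹ * hartree (fun x => density G x - μ x)

/-- The value `inf {energy b μ G : G ≥ 0, Tr G = ∫ μ}` of the minimization problem. -/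
def infEnergy (b : ℝ) (μ : ℝ → ℝ) : ℝ≥0∞ := ⨅ G ∈ states (∫ x, μ x), energy b μ G

/-- Minimizers of the reduced Hartree-Fock problem. -/
def IsMinimizer (b : ℝ) (μ : ℝ → ℝ) (G : Op) : Prop :=
  G ∈ states (∫ x, μ x) ∧ energy b μ G = infEnergy b μ

/-! ### The definitions are meaningful: independence of the basis, properties of `F(b, ·)` -/

/-- `F(b, ·)` is continuous, so the functional calculus in `FOp` applies to it. -/
theorem continuous_F (b : ℝ) : Continuous (F b) := by
  have h : Continuous ((fun t : ℝ => t * (1 - t)) ∘ Int.fract) :=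
    ContinuousOn.comp_fract'' (by fun_prop) (by norm_num)
  have h2 : Continuous fun g : ℝ => ((fun t : ℝ => t * (1 - t)) ∘ Int.fract) (2 * Real.pi * g / b) :=
    h.comp (by fun_prop)
  unfold F
  exact (by fun_prop : Continuous fun g : ℝ => Real.pi * g ^ 2).add (continuous_const.mul h2)

theorem F_nonneg (b g : ℝ) : 0 ≤ F b g := by
  have h1 := Int.fract_nonneg (2 * Real.pi * g / b)
  have h2 : 0 ≤ 1 - Int.fract (2 * Real.pi * g / b) :=
    sub_nonneg.2 (Int.fract_lt_one (2 * Real.pi * g / b)).le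
  unfold F
  positivity

theorem funOp_isPositive {H : Type*} [NormedAddCommGroup H] [InnerProductSpace ℂ H]
    [CompleteSpace H] {f : ℝ → ℝ} (hf : ∀ t, 0 ≤ f t) (G : H →L[ℂ] H) :
    (funOp f G).IsPositive :=
  (ContinuousLinearMap.nonneg_iff_isPositive _).1 (cfc_nonneg fun t _ => hf t)

/-- `F(b, G)` is a positive operator, so its trace is meaningful. -/
theorem FOp_isPositive (b : ℝ) (G : Op) : (FOp b G).IsPositive :=
  funOp_isPositive (F_nonneg b) G

theorem parseval {ι H : Type*} [NormedAddCommGroup H] [InnerProductSpace ℂ H]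
    (f : HilbertBasis ι ℂ H) (x : H) : ‖x‖ₑ ^ 2 = ∑' j, ‖inner ℂ (f j) x‖ₑ ^ 2 := by
  have h := f.hasSum_inner_mul_inner x x
  have h2 : HasSum (fun j => ‖inner ℂ (f j) x‖ ^ 2) (‖x‖ ^ 2) := by
    have h3 := (Complex.hasSum_re h)
    rw [inner_self_eq_norm_sq_to_K] at h3
    convert h3 using 1
    · ext j
      rw [← inner_conj_symm x, Complex.conj_mul']
      norm_cast
    · norm_cast
  have h4 := ENNReal.ofReal_tsum_of_nonneg (fun j => sq_nonneg ‖inner ℂ (f j) x‖) h2.summable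
  rw [h2.tsum_eq] at h4
  simpa [ENNReal.ofReal_pow, ofReal_norm] using h4

theorem tsum_enorm_sq_adjoint {ι κ H H' : Type*} [NormedAddCommGroup H] [InnerProductSpace ℂ H]
    [CompleteSpace H] [NormedAddCommGroup H'] [InnerProductSpace ℂ H'] [CompleteSpace H']
    (e : HilbertBasis ι ℂ H) (f : HilbertBasis κ ℂ H') (T : H →L[ℂ] H') :
    ∑' i, ‖T (e i)‖ₑ ^ 2 = ∑' j, ‖ContinuousLinearMap.adjoint T (f j)‖ₑ ^ 2 := by
  simp_rw [parseval f (T _), parseval e (ContinuousLinearMap.adjoint T _)]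
  rw [ENNReal.tsum_comm]
  refine tsum_congr fun j => tsum_congr fun i => ?_
  rw [ContinuousLinearMap.adjoint_inner_right, ← inner_conj_symm, ← ofReal_norm, ← ofReal_norm,
    RCLike.norm_conj]

theorem tsum_enorm_sq_eq {ι κ H H' : Type*} [NormedAddCommGroup H] [InnerProductSpace ℂ H]
    [CompleteSpace H] [NormedAddCommGroup H'] [InnerProductSpace ℂ H'] [CompleteSpace H']
    (e : HilbertBasis ι ℂ H) (e' : HilbertBasis κ ℂ H) (T : H →L[ℂ] H') :
    ∑' i, ‖T (e i)‖ₑ ^ 2 = ∑' j, ‖T (e' j)‖ₑ ^ 2 := by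
  obtain ⟨w, f, -⟩ := exists_hilbertBasis ℂ H'
  rw [tsum_enorm_sq_adjoint e f, tsum_enorm_sq_adjoint e' f]

theorem countable_of_basis {ι H : Type*} [NormedAddCommGroup H] [InnerProductSpace ℂ H]
    [TopologicalSpace.SeparableSpace H] (e : HilbertBasis ι ℂ H) : Countable ι := by
  refine Pairwise.countable_of_isOpen_disjoint (s := fun i => Metric.ball (e i) (1 / 2)) ?_
    (fun i => Metric.isOpen_ball) fun i => ⟨e i, Metric.mem_ball_self (by norm_num)⟩
  intro i j hij
  refine Metric.ball_disjoint_ball ?_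
  have h : ‖e i - e j‖ ^ 2 = 2 := by
    rw [@norm_sub_sq ℂ, e.orthonormal.1 i, e.orthonormal.1 j, e.orthonormal.2 hij]
    norm_num
  rw [dist_eq_norm]
  nlinarith [norm_nonneg (e i - e j)]

theorem countable_index {ι : Type*} (e : HilbertBasis ι ℂ L2) : Countable ι := by
  have : Fact ((2 : ℝ≥0∞) ≠ ∞) := ⟨by norm_num⟩
  have : SecondCountableTopology L2 := Lp.SecondCountableTopology
  exact countable_of_basis e

theorem enorm_sq_eq_lintegral {ν : Measure ℝ} (u : Lp ℂ 2 ν) :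
    ‖u‖ₑ ^ 2 = ∫⁻ x, ‖u x‖ₑ ^ 2 ∂ν := by
  rw [Lp.enorm_def, eLpNorm_eq_lintegral_rpow_enorm_toReal (by norm_num) (by norm_num),
    ← ENNReal.rpow_natCast, ← ENNReal.rpow_mul]
  simp

theorem aemeasurable_enorm_sq (u : L2) : AEMeasurable fun x => ‖u x‖ₑ ^ 2 :=
  (Lp.aestronglyMeasurable u).enorm.pow_const 2

theorem setLIntegral_tsum {ι : Type*} (e : HilbertBasis ι ℂ L2) (T : Op) (s : Set ℝ) :
    ∫⁻ x in s, ∑' i, ‖(T (e i) : L2) x‖ₑ ^ 2 =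
      ∑' i, ‖(LpToLpRestrictCLM ℝ ℂ ℂ volume 2 s ∘L T) (e i)‖ₑ ^ 2 := by
  have := countable_index e
  rw [lintegral_tsum fun i => (aemeasurable_enorm_sq (T (e i))).restrict]
  refine tsum_congr fun i => ?_
  rw [enorm_sq_eq_lintegral]
  refine lintegral_congr_ae ?_
  filter_upwards [LpToLpRestrictCLM_coeFn ℂ s (T (e i))] with x hx
  rw [ContinuousLinearMap.comp_apply, hx]

/-- The function `∑ᵢ |(T eᵢ)(x)|²` does not depend on the basis, up to null sets. -/
theorem tsum_enorm_apply_ae_eq {ι κ : Type*} (e : HilbertBasis ι ℂ L2) (e' : HilbertBasis κ ℂ L2)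
    (T : Op) : (fun x => ∑' i, ‖(T (e i) : L2) x‖ₑ ^ 2) =ᵐ[volume]
      fun x => ∑' j, ‖(T (e' j) : L2) x‖ₑ ^ 2 := by
  have := countable_index e
  have := countable_index e'
  refine ae_eq_of_forall_setLIntegral_eq_of_sigmaFinite₀
    (AEMeasurable.tsum fun i => aemeasurable_enorm_sq _)
    (AEMeasurable.tsum fun i => aemeasurable_enorm_sq _) fun s _ _ => ?_
  rw [setLIntegral_tsum, setLIntegral_tsum]
  exact tsum_enorm_sq_eq e e' _

theorem re_inner_eq {H : Type*} [NormedAddCommGroup H] [InnerProductSpace ℂ H] [CompleteSpace H]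
    {G : H →L[ℂ] H} (hG : G.IsPositive) (u : H) :
    ENNReal.ofReal (RCLike.re (inner ℂ u (G u))) = ‖sqrtOp G u‖ₑ ^ 2 := by
  have h0 : 0 ≤ G := (ContinuousLinearMap.nonneg_iff_isPositive G).2 hG
  have h1 : (CFC.sqrt G).IsPositive :=
    (ContinuousLinearMap.nonneg_iff_isPositive _).1 (CFC.sqrt_nonneg G)
  have h2 : inner ℂ u (G u) = inner ℂ (CFC.sqrt G u) (CFC.sqrt G u) := by
    conv_lhs => rw [← CFC.sqrt_mul_sqrt_self G h0]
    exact (h1.isSymmetric u (CFC.sqrt G u)).symm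
  rw [h2, inner_self_eq_norm_sq, ENNReal.ofReal_pow (norm_nonneg _), ofReal_norm]
  rfl

/-- The trace of a positive operator does not depend on the basis. -/
theorem traceIn_eq {ι : Type*} (e : HilbertBasis ι ℂ L2) {G : Op} (hG : G.IsPositive) :
    traceIn e G = trace G := by
  simp_rw [trace, traceIn, re_inner_eq hG]
  exact tsum_enorm_sq_eq e basis (sqrtOp G)

theorem kineticIn_eq_lintegral {ι : Type*} (e : HilbertBasis ι ℂ L2) (G : Op) :
    kineticIn e G = ∫⁻ ξ : ℝ, ENNReal.ofReal ((2 * Real.pi * ξ) ^ 2) *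
      ∑' i, ‖(𝓕 (sqrtOp G (e i)) : L2) ξ‖ₑ ^ 2 := by
  have := countable_index e
  simp_rw [← ENNReal.tsum_mul_left]
  have hm : ∀ i, AEMeasurable fun ξ : ℝ => ENNReal.ofReal ((2 * Real.pi * ξ) ^ 2) *
      ‖(𝓕 (sqrtOp G (e i)) : L2) ξ‖ₑ ^ 2 := fun i =>
    AEMeasurable.mul (by fun_prop) (aemeasurable_enorm_sq _)
  exact (lintegral_tsum hm).symm

/-- The kinetic energy does not depend on the basis. -/
theorem kineticIn_eq {ι : Type*} (e : HilbertBasis ι ℂ L2) (G : Op) :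
    kineticIn e G = traceLaplace G := by
  rw [traceLaplace, kineticIn_eq_lintegral, kineticIn_eq_lintegral]
  refine lintegral_congr_ae ?_
  let T : Op := (Lp.fourierTransformₗᵢ ℝ ℂ : L2 →L[ℂ] L2) ∘L sqrtOp G
  filter_upwards [tsum_enorm_apply_ae_eq e basis T] with ξ hξ
  exact congrArg _ hξ

/-- The density does not depend on the basis, up to null sets. -/
theorem densityIn_ae_eq {ι : Type*} (e : HilbertBasis ι ℂ L2) (G : Op) :
    densityIn e G =ᵐ[volume] densityIn basis G :=
  tsum_enorm_apply_ae_eq e basis (sqrtOp G)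

/-- `∫ ρ_G = Tr G`; in particular, `ρ_G` is integrable and a.e. finite if `Tr G < ∞`. -/
theorem lintegral_densityIn {ι : Type*} (e : HilbertBasis ι ℂ L2) {G : Op} (hG : G.IsPositive) :
    ∫⁻ x, densityIn e G x = trace G := by
  have := countable_index e
  rw [← traceIn_eq e hG]
  simp_rw [densityIn, traceIn, re_inner_eq hG]
  rw [lintegral_tsum fun i => aemeasurable_enorm_sq _]
  simp_rw [enorm_sq_eq_lintegral]

end RHF

end

open MeasureTheory FourierTransform
open scoped ENNReal

noncomputable section

namespace RHF

open Filter Topology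

/-! ### Hilbert–Schmidt sums `Tr(C G C†)` and their behaviour under weak convergence. -/

section HilbertSchmidt

variable {K : Type*} [NormedAddCommGroup K] [InnerProductSpace ℂ K] [CompleteSpace K]

/-! Existence is the direct method. A minimizing sequence is bounded in operator norm by `ν`, so
along an ultrafilter its quadratic forms converge to that of some `G ≥ 0` (`exists_weak_limit`).
Each term of the energy is lower semicontinuous. The kinetic term is the integral of a nonnegative
weight against a momentum measure that depends linearly on `G`. The term `Tr F(b, G)` is handled by
Peierls' inequality in an eigenbasis of the limit, because `F(b, ·)` is convex: `π g²` plus the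
fractional-part term is the piecewise linear interpolation of a parabola. The Hartree term follows
from Fatou once the distribution functions of the densities converge pointwise.

The real issue is loss of mass. In one dimension a bounded Hartree energy prevents it: distribution
functions are monotone, so too much mass far away would keep `W_{ρ-μ}` away from zero on a long
interval (`exists_posMeasure_compl_le`). The kinetic energy gives tightness in momentum. The cutoff
to a bounded phase space box is Hilbert–Schmidt, so the mass inside the box passes to the limit
(`trace_eq_of_formTendsto`).

For uniqueness, the midpoint of two minimizers is tested: the first two terms are convex and the
Hartree term is a squared `L²` norm, so the parallelogram identity forces equal distribution
functions. Finiteness comes from a trial state built of translated bumps that carries on each unit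
cell the same mass as `μ` (`infEnergy_lt_top`). -/

theorem sqrtOp_adjoint {H : Type*} [NormedAddCommGroup H] [InnerProductSpace ℂ H]
    [CompleteSpace H] (G : H →L[ℂ] H) : ContinuousLinearMap.adjoint (sqrtOp G) = sqrtOp G :=
  (((ContinuousLinearMap.nonneg_iff_isPositive _).1 (CFC.sqrt_nonneg G)).isSelfAdjoint).adjoint_eq

theorem sqrtOp_mul_self {H : Type*} [NormedAddCommGroup H] [InnerProductSpace ℂ H]
    [CompleteSpace H] {G : H →L[ℂ] H} (hG : G.IsPositive) : sqrtOp G * sqrtOp G = G :=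
  CFC.sqrt_mul_sqrt_self G ((ContinuousLinearMap.nonneg_iff_isPositive G).2 hG)

/-- `Tr(C G C†) = ∑ᵢ ‖C G^{1/2} eᵢ‖²` for `G ≥ 0`. -/
def hsSq (C : L2 →L[ℂ] K) (G : Op) : ℝ≥0∞ := ∑' i, ‖C (sqrtOp G (basis i))‖ₑ ^ 2

/-- Taking the adjoint of `C G^{1/2}` eliminates the square root: `G` now enters only through its
quadratic form, hence linearly. Additivity and both limit theorems for `hsSq` rest on this form. -/
theorem hsSq_eq_tsum {κ : Type*} (f : HilbertBasis κ ℂ K) (C : L2 →L[ℂ] K) {G : Op}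
    (hG : G.IsPositive) :
    hsSq C G = ∑' j, ENNReal.ofReal (RCLike.re (inner ℂ (ContinuousLinearMap.adjoint C (f j))
      (G (ContinuousLinearMap.adjoint C (f j))))) := by
  simp_rw [re_inner_eq hG]
  have h := tsum_enorm_sq_adjoint basis f (C ∘L sqrtOp G)
  rw [ContinuousLinearMap.adjoint_comp, sqrtOp_adjoint] at h
  exact h

theorem trace_eq_hsSq {G : Op} (hG : G.IsPositive) :
    trace G = hsSq (ContinuousLinearMap.id ℂ L2) G := by
  simp_rw [trace, traceIn, re_inner_eq hG]
  rfl

theorem isPositive_real_smul {G : Op} (hG : G.IsPositive) {a : ℝ} (ha : 0 ≤ a) :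
    ((a : ℂ) • G).IsPositive :=
  hG.smul_of_nonneg (by exact_mod_cast ha)

theorem hsSq_add_smul (C : L2 →L[ℂ] K) {G₁ G₂ : Op} (h₁ : G₁.IsPositive) (h₂ : G₂.IsPositive)
    {a b : ℝ} (ha : 0 ≤ a) (hb : 0 ≤ b) :
    hsSq C ((a : ℂ) • G₁ + (b : ℂ) • G₂) =
      ENNReal.ofReal a * hsSq C G₁ + ENNReal.ofReal b * hsSq C G₂ := by
  obtain ⟨w, f, -⟩ := exists_hilbertBasis ℂ K
  rw [hsSq_eq_tsum f C h₁, hsSq_eq_tsum f C h₂, hsSq_eq_tsum f C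
    ((isPositive_real_smul h₁ ha).add (isPositive_real_smul h₂ hb)), ← ENNReal.tsum_mul_left,
    ← ENNReal.tsum_mul_left, ← ENNReal.tsum_add]
  refine tsum_congr fun j => ?_
  rw [← ENNReal.ofReal_mul ha, ← ENNReal.ofReal_mul hb, ← ENNReal.ofReal_add
    (mul_nonneg ha (h₁.re_inner_nonneg_right _)) (mul_nonneg hb (h₂.re_inner_nonneg_right _))]
  rw [add_apply, FunLike.coe_smul, FunLike.coe_smul, Pi.smul_apply, Pi.smul_apply, inner_add_right,
    inner_smul_right, inner_smul_right, map_add]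
  simp only [RCLike.re_to_complex, Complex.re_ofReal_mul]

/-- The operator norm is at most the Hilbert–Schmidt norm: expand `T u` in the basis and apply
Cauchy–Schwarz to each coefficient. -/
theorem enorm_apply_sq_le {H : Type*} [NormedAddCommGroup H] [InnerProductSpace ℂ H]
    [CompleteSpace H] {ι : Type*} (e : HilbertBasis ι ℂ H) (T : H →L[ℂ] H) (u : H) :
    ‖T u‖ₑ ^ 2 ≤ (∑' i, ‖T (e i)‖ₑ ^ 2) * ‖u‖ₑ ^ 2 := by
  rw [tsum_enorm_sq_adjoint e e, parseval e (T u), ← ENNReal.tsum_mul_right]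
  refine ENNReal.tsum_le_tsum fun i => ?_
  rw [← mul_pow, ← ContinuousLinearMap.adjoint_inner_left]
  refine pow_le_pow_left' ?_ 2
  simp only [← ofReal_norm, ← ENNReal.ofReal_mul (norm_nonneg _)]
  exact ENNReal.ofReal_le_ofReal (norm_inner_le_norm _ _)

theorem re_inner_le_trace {G : Op} (hG : G.IsPositive) {ν : ℝ} (hν : 0 ≤ ν)
    (h : trace G = ENNReal.ofReal ν) (u : L2) :
    RCLike.re (inner ℂ u (G u)) ≤ ν * ‖u‖ ^ 2 := by
  have h1 := enorm_apply_sq_le basis (sqrtOp G) u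
  rw [← re_inner_eq hG] at h1
  simp_rw [← re_inner_eq hG] at h1
  change _ ≤ trace G * _ at h1
  rw [h, ← ofReal_norm, ← ENNReal.ofReal_pow (norm_nonneg _), ← ENNReal.ofReal_mul hν] at h1
  exact (ENNReal.ofReal_le_ofReal_iff (by positivity)).1 h1

theorem norm_le_of_trace {G : Op} (hG : G.IsPositive) {ν : ℝ} (hν : 0 ≤ ν)
    (h : trace G = ENNReal.ofReal ν) : ‖G‖ ≤ ν := by
  have hs : ‖sqrtOp G‖ ≤ Real.sqrt ν := by
    refine ContinuousLinearMap.opNorm_le_bound _ (Real.sqrt_nonneg _) fun u => ?_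
    have h1 := enorm_apply_sq_le basis (sqrtOp G) u
    simp_rw [← re_inner_eq hG] at h1
    change _ ≤ trace G * _ at h1
    rw [re_inner_eq hG, h, ← ofReal_norm, ← ofReal_norm, ← ENNReal.ofReal_pow (norm_nonneg _),
      ← ENNReal.ofReal_pow (norm_nonneg _), ← ENNReal.ofReal_mul hν,
      ENNReal.ofReal_le_ofReal_iff (by positivity)] at h1
    refine abs_le_of_sq_le_sq' ?_ (by positivity) |>.2
    rw [mul_pow, Real.sq_sqrt hν]
    exact h1
  rw [← sqrtOp_mul_self hG]
  calc _ ≤ ‖sqrtOp G‖ * ‖sqrtOp G‖ := norm_mul_le _ _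
    _ ≤ Real.sqrt ν * Real.sqrt ν := by gcongr
    _ = ν := Real.mul_self_sqrt hν

/-- Convergence of the quadratic forms of operators. -/
def FormTendsto (U : Filter ℕ) (Gn : ℕ → Op) (G : Op) : Prop :=
  ∀ u : L2, Tendsto (fun n => RCLike.re (inner ℂ u (Gn n u))) U (𝓝 (RCLike.re (inner ℂ u (G u))))

/-- Fatou for series: every finite partial sum of nonnegative terms converges. -/
theorem hsSq_le_of_tendsto {U : Filter ℕ} [U.NeBot] {Gn : ℕ → Op} {G : Op}
    (hGn : ∀ n, (Gn n).IsPositive) (hG : G.IsPositive) (h : FormTendsto U Gn G)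
    (C : L2 →L[ℂ] K) {l : ℝ≥0∞} (hl : Tendsto (fun n => hsSq C (Gn n)) U (𝓝 l)) :
    hsSq C G ≤ l := by
  obtain ⟨w, f, -⟩ := exists_hilbertBasis ℂ K
  rw [hsSq_eq_tsum f C hG, ENNReal.tsum_eq_iSup_sum]
  refine iSup_le fun s => le_of_tendsto_of_tendsto'
    (tendsto_finsetSum s fun j _ => ENNReal.tendsto_ofReal (h _)) hl fun n => ?_
  rw [hsSq_eq_tsum f C (hGn n)]
  exact ENNReal.sum_le_tsum s

/-- Dominated convergence: `G ≤ ν` bounds the `j`-th term by `ν ‖C† fⱼ‖²`, which is summable because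
`C` is Hilbert–Schmidt. -/
theorem tendsto_hsSq_of_hilbertSchmidt {U : Filter ℕ} {Gn : ℕ → Op} {G : Op}
    (hGn : ∀ n, (Gn n).IsPositive) (hG : G.IsPositive) (h : FormTendsto U Gn G)
    {ν : ℝ} (hν : 0 ≤ ν) (hν' : ∀ n, trace (Gn n) = ENNReal.ofReal ν)
    (C : L2 →L[ℂ] K) (hC : ∑' i, ‖C (basis i)‖ₑ ^ 2 ≠ ∞) :
    Tendsto (fun n => hsSq C (Gn n)) U (𝓝 (hsSq C G)) := by
  obtain ⟨w, f, -⟩ := exists_hilbertBasis ℂ K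
  rw [tsum_enorm_sq_adjoint basis f] at hC
  have hs : Summable fun j => ν * ‖ContinuousLinearMap.adjoint C (f j)‖ ^ 2 := by
    refine Summable.mul_left ν ?_
    refine (ENNReal.summable_toReal hC).congr fun j => ?_
    rw [ENNReal.toReal_pow, toReal_enorm]
  have hle : ∀ n j, RCLike.re (inner ℂ (ContinuousLinearMap.adjoint C (f j))
      (Gn n (ContinuousLinearMap.adjoint C (f j)))) ≤
      ν * ‖ContinuousLinearMap.adjoint C (f j)‖ ^ 2 := fun n j =>
    re_inner_le_trace (hGn n) hν (hν' n) _
  have hn : ∀ n j, 0 ≤ RCLike.re (inner ℂ (ContinuousLinearMap.adjoint C (f j))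
      (Gn n (ContinuousLinearMap.adjoint C (f j)))) := fun n j => (hGn n).re_inner_nonneg_right _
  have key := tendsto_tsum_of_dominated_convergence hs
    (fun j => h (ContinuousLinearMap.adjoint C (f j)))
    (Eventually.of_forall fun n j => by
      rw [Real.norm_of_nonneg (hn n j)]; exact hle n j)
  have key2 := ENNReal.tendsto_ofReal key
  rcases U.eq_or_neBot with rfl | hU
  · exact tendsto_bot
  have hle' : ∀ j, RCLike.re (inner ℂ (ContinuousLinearMap.adjoint C (f j))
      (G (ContinuousLinearMap.adjoint C (f j)))) ≤
      ν * ‖ContinuousLinearMap.adjoint C (f j)‖ ^ 2 := fun j =>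
    le_of_tendsto (h _) (Eventually.of_forall fun n => hle n j)
  have hn' := fun j => hG.re_inner_nonneg_right (ContinuousLinearMap.adjoint C (f j))
  rw [ENNReal.ofReal_tsum_of_nonneg hn' (Summable.of_nonneg_of_le hn' hle' hs)] at key2
  rw [hsSq_eq_tsum f C hG]
  refine key2.congr fun n => ?_
  rw [ENNReal.ofReal_tsum_of_nonneg (hn n) (Summable.of_nonneg_of_le (hn n) (hle n) hs),
    hsSq_eq_tsum f C (hGn n)]

end HilbertSchmidt

/-! ### Position and momentum distributions of a state as measures. -/

section MassMeasure

/-- The measure with density `∑ᵢ |(V G^{1/2} eᵢ)(x)|²`. -/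
def massMeasure (V : Op) (G : Op) : Measure ℝ :=
  volume.withDensity fun x => ∑' i, ‖(V (sqrtOp G (basis i)) : L2) x‖ₑ ^ 2

theorem massMeasure_apply (V G : Op) {s : Set ℝ} (hs : MeasurableSet s) :
    massMeasure V G s = hsSq (LpToLpRestrictCLM ℝ ℂ ℂ volume 2 s ∘L V) G := by
  rw [massMeasure, withDensity_apply _ hs]
  exact setLIntegral_tsum basis (V ∘L sqrtOp G) s

theorem aemeasurable_massDensity (V G : Op) :
    AEMeasurable fun x => ∑' i, ‖(V (sqrtOp G (basis i)) : L2) x‖ₑ ^ 2 := by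
  have := countable_index basis
  exact AEMeasurable.tsum fun i => aemeasurable_enorm_sq _

theorem massMeasure_add_smul (V : Op) {G₁ G₂ : Op} (h₁ : G₁.IsPositive) (h₂ : G₂.IsPositive)
    {a b : ℝ} (ha : 0 ≤ a) (hb : 0 ≤ b) :
    massMeasure V ((a : ℂ) • G₁ + (b : ℂ) • G₂) =
      ENNReal.ofReal a • massMeasure V G₁ + ENNReal.ofReal b • massMeasure V G₂ := by
  ext s hs
  simp only [Measure.add_apply, Measure.smul_apply, smul_eq_mul, massMeasure_apply V _ hs]
  exact hsSq_add_smul _ h₁ h₂ ha hb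

/-- Semicontinuity is known set by set, so `w` is approximated from below by simple functions. The
hypothesis `hU`, valid for ultrafilters, supplies limits of the masses of their level sets. -/
theorem lintegral_massMeasure_le_of_tendsto {U : Filter ℕ} [U.NeBot] {Gn : ℕ → Op} {G : Op}
    (hGn : ∀ n, (Gn n).IsPositive) (hG : G.IsPositive) (h : FormTendsto U Gn G) (V : Op)
    (hU : ∀ f : ℕ → ℝ≥0∞, ∃ l, Tendsto f U (𝓝 l)) (w : ℝ → ℝ≥0∞)
    {l : ℝ≥0∞} (hl : Tendsto (fun n => ∫⁻ x, w x ∂massMeasure V (Gn n)) U (𝓝 l)) :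
    ∫⁻ x, w x ∂massMeasure V G ≤ l := by
  rw [lintegral_eq_nnreal]
  refine iSup₂_le fun g hg => ?_
  choose L hL using fun c : NNReal => hU fun n => massMeasure V (Gn n) (g ⁻¹' {c})
  have h1 : ∀ c, massMeasure V G (g ⁻¹' {c}) ≤ L c := fun c => by
    have hm : MeasurableSet (g ⁻¹' {c}) := g.measurableSet_fiber c
    have := hL c
    simp_rw [massMeasure_apply V _ hm] at this ⊢
    exact hsSq_le_of_tendsto hGn hG h _ this
  have h2 : ∀ n, (g.map (↑)).lintegral (massMeasure V (Gn n)) ≤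
      ∫⁻ x, w x ∂massMeasure V (Gn n) := fun n => by
    rw [← SimpleFunc.lintegral_eq_lintegral]
    exact lintegral_mono hg
  simp_rw [SimpleFunc.map_lintegral] at h2 ⊢
  calc ∑ c ∈ g.range, (c : ℝ≥0∞) * massMeasure V G (g ⁻¹' {c})
      ≤ ∑ c ∈ g.range, (c : ℝ≥0∞) * L c :=
        Finset.sum_le_sum fun c _ => mul_le_mul_right (h1 c) _
    _ ≤ l := le_of_tendsto_of_tendsto' (tendsto_finsetSum _ fun c _ =>
        ENNReal.Tendsto.const_mul (hL c) (Or.inr ENNReal.coe_ne_top)) hl h2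

theorem densityIn_lintegral_eq (G : Op) (s : Set ℝ) (hs : MeasurableSet s) :
    ∫⁻ x in s, densityIn basis G x = massMeasure (ContinuousLinearMap.id ℂ L2) G s := by
  rw [massMeasure, withDensity_apply _ hs]
  rfl

/-- The Fourier transform as a bounded operator on `L²(ℝ)`. -/
def fourierOp : Op := (Lp.fourierTransformₗᵢ ℝ ℂ : L2 →L[ℂ] L2)

theorem traceLaplace_eq_lintegral (G : Op) :
    traceLaplace G = ∫⁻ ξ, ENNReal.ofReal ((2 * Real.pi * ξ) ^ 2) ∂massMeasure fourierOp G := by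
  rw [massMeasure, lintegral_withDensity_eq_lintegral_mul₀ (aemeasurable_massDensity _ _)
    (by fun_prop), traceLaplace, kineticIn_eq_lintegral]
  refine lintegral_congr fun ξ => ?_
  rw [Pi.mul_apply, mul_comm]
  rfl

end MassMeasure

/-! ### Convexity and linear growth of `F(b, ·)`. -/

section Convexity

/-- With `x = 2πg/b`, the bracket equals `x² + {x}(1 - {x})`, written as the chord of the parabola
over `[⌊x⌋, ⌊x⌋ + 1]`. -/
theorem F_eq_of_ne_zero {b : ℝ} (hb : b ≠ 0) (g : ℝ) :
    F b g = b ^ 2 / (4 * Real.pi) * (⌊2 * Real.pi * g / b⌋ ^ 2 +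
      (2 * ⌊2 * Real.pi * g / b⌋ + 1) * (2 * Real.pi * g / b - ⌊2 * Real.pi * g / b⌋)) := by
  have hg : g = b * (2 * Real.pi * g / b) / (2 * Real.pi) := by field_simp
  rw [F, ← Int.self_sub_floor]
  set x := 2 * Real.pi * g / b
  have h : Real.pi * g ^ 2 = b ^ 2 / (4 * Real.pi) * x ^ 2 := by
    rw [hg]; field_simp; ring
  rw [h]
  ring

/-- The line through two points of the parabola with consecutive integer abscissas lies below the
piecewise linear interpolation of the parabola at the integers. -/
theorem chord_le_interpolation (x y : ℝ) :
    (⌊x⌋ : ℝ) ^ 2 + (2 * ⌊x⌋ + 1) * (y - ⌊x⌋) ≤ ⌊y⌋ ^ 2 + (2 * ⌊y⌋ + 1) * (y - ⌊y⌋) := by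
  have h0 := Int.floor_le y
  have h1 := (Int.lt_floor_add_one y).le
  rcases le_or_gt ⌊x⌋ ⌊y⌋ with h | h
  · rcases h.eq_or_lt with h | h
    · rw [h]
    · have h' : (⌊x⌋ : ℝ) + 1 ≤ ⌊y⌋ := by exact_mod_cast h
      nlinarith
  · have h' : (⌊y⌋ : ℝ) + 1 ≤ ⌊x⌋ := by exact_mod_cast h
    nlinarith

/-- `F(b, ·)` is convex: it has a supporting line at every point. -/
theorem exists_subgradient_F (b s : ℝ) : ∃ c, ∀ t, F b s + c * (t - s) ≤ F b t := by
  rcases eq_or_ne b 0 with rfl | hb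
  · refine ⟨2 * Real.pi * s, fun t => ?_⟩
    -- Division by zero gives `0`, so the fractional part vanishes and only the parabola remains.
    simp only [F, div_zero, Int.fract_zero, zero_mul, mul_zero, add_zero]
    nlinarith [mul_nonneg Real.pi_pos.le (sq_nonneg (t - s))]
  -- The slope of the chord over the cell containing `2πs/b`, rescaled by the chain rule.
  · refine ⟨b ^ 2 / (4 * Real.pi) * ((2 * ⌊2 * Real.pi * s / b⌋ + 1) * (2 * Real.pi / b)),
      fun t => ?_⟩
    rw [F_eq_of_ne_zero hb, F_eq_of_ne_zero hb]
    have h := mul_le_mul_of_nonneg_left (chord_le_interpolation (2 * Real.pi * s / b)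
      (2 * Real.pi * t / b)) (by positivity : 0 ≤ b ^ 2 / (4 * Real.pi))
    refine le_of_eq_of_le ?_ h
    ring

theorem F_midpoint_le (b s t : ℝ) : F b (2⁻¹ * s + 2⁻¹ * t) ≤ 2⁻¹ * F b s + 2⁻¹ * F b t := by
  obtain ⟨c, hc⟩ := exists_subgradient_F b (2⁻¹ * s + 2⁻¹ * t)
  linarith [hc s, hc t]

/-- On the interval `[0, ν]`, `F(b, ·)` is dominated by a multiple of the identity, since `{x}(1 -
{x}) ≤ |x|`; hence `Tr F(b, G)` is finite whenever `Tr G = ν`. -/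
theorem F_le_linear (b : ℝ) {ν t : ℝ} (ht : 0 ≤ t) (htν : t ≤ ν) :
    F b t ≤ (Real.pi * ν + |b| / 2) * t := by
  have h1 : Real.pi * t ^ 2 ≤ Real.pi * ν * t := by
    rw [mul_assoc]
    exact mul_le_mul_of_nonneg_left (by nlinarith) Real.pi_pos.le
  have h2 : b ^ 2 / (4 * Real.pi) * (Int.fract (2 * Real.pi * t / b) *
      (1 - Int.fract (2 * Real.pi * t / b))) ≤ |b| / 2 * t := by
    rcases eq_or_ne b 0 with rfl | hb
    · simp
    have hx : Int.fract (2 * Real.pi * t / b) * (1 - Int.fract (2 * Real.pi * t / b)) ≤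
        |2 * Real.pi * t / b| := by
      set x := 2 * Real.pi * t / b
      have h3 := Int.fract_nonneg x
      have h4 := (Int.fract_lt_one x).le
      rcases le_or_gt 0 x with h | h
      · rw [abs_of_nonneg h]
        have h5 : Int.fract x ≤ x := by
          have : (0 : ℝ) ≤ ⌊x⌋ := by exact_mod_cast Int.floor_nonneg.2 h
          linarith [Int.self_sub_floor x]
        nlinarith
      · rw [abs_of_neg h]
        have h5 : 1 - Int.fract x ≤ - x := by
          have : (⌊x⌋ : ℝ) ≤ -1 := by exact_mod_cast Int.le_sub_one_of_lt (Int.floor_lt_zero.2 h)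
          linarith [Int.self_sub_floor x]
        nlinarith
    have h6 : |2 * Real.pi * t / b| = 2 * Real.pi * t / |b| := by
      rw [abs_div, abs_of_nonneg (by positivity)]
    have hb' : 0 < |b| := abs_pos.2 hb
    calc _ ≤ b ^ 2 / (4 * Real.pi) * (2 * Real.pi * t / |b|) := by
          rw [← h6]; exact mul_le_mul_of_nonneg_left hx (by positivity)
      _ = |b| / 2 * t := by
          rw [← sq_abs]; field_simp; ring
  rw [F]
  linarith

end Convexity

/-! ### Peierls' inequality, eigenvectors and eigenbases. -/

section FunctionalCalculus

universe u

variable {H : Type*} [NormedAddCommGroup H] [InnerProductSpace ℂ H] [CompleteSpace H]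

/-- Peierls' inequality. -/
theorem le_inner_funOp {G : H →L[ℂ] H} (hG : G.IsPositive) {f : ℝ → ℝ} (hf : Continuous f)
    (hconv : ∀ s, ∃ c, ∀ t, f s + c * (t - s) ≤ f t) {e : H} (he : ‖e‖ = 1) :
    f (RCLike.re (inner ℂ e (G e))) ≤ RCLike.re (inner ℂ e (funOp f G e)) := by
  have hsa : IsSelfAdjoint G := hG.isSelfAdjoint
  set s := RCLike.re (inner ℂ e (G e)) with hs
  obtain ⟨c, hc⟩ := hconv s
  -- The supporting line of `f` at `s = ⟨e, G e⟩` is transferred to operators; its expectation in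
  -- the unit vector `e` is exactly `f s`.
  have h1 : cfc (fun t : ℝ => f s - c * s + c * t) G ≤ cfc f G :=
    cfc_mono (fun t _ => by linarith [hc t]) (by fun_prop) hf.continuousOn
  rw [cfc_const_add _ _ _ (by fun_prop), cfc_const_mul_id c G] at h1
  have h2 := ((ContinuousLinearMap.le_def _ _).1 h1).re_inner_nonneg_right e
  rw [sub_apply, add_apply, ContinuousLinearMap.algebraMap_apply, inner_sub_right,
    inner_add_right, map_sub, map_add, smul_apply] at h2
  rw [← Complex.coe_smul, ← Complex.coe_smul, inner_smul_right, inner_smul_right,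
    inner_self_eq_norm_sq_to_K, he] at h2
  simp only [RCLike.re_to_complex, RCLike.ofReal_one, one_pow, mul_one, Complex.re_ofReal_mul,
    Complex.ofReal_re] at h2 hs ⊢
  rw [← hs] at h2
  rw [funOp]
  linarith

theorem funOp_apply_eigenvector {G : H →L[ℂ] H} (hG : IsSelfAdjoint G) {f : ℝ → ℝ}
    (hf : Continuous f) {e : H} {l : ℝ} (he : e ≠ 0) (hl : G e = (l : ℂ) • e) :
    funOp f G e = (f l : ℂ) • e := by
  have hmem : l ∈ spectrum ℝ G := by
    rw [spectrum.mem_iff]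
    rintro ⟨u, hu⟩
    have h1 : (algebraMap ℝ (H →L[ℂ] H) l - G) e = 0 := by
      rw [sub_apply, ContinuousLinearMap.algebraMap_apply, hl, Complex.coe_smul, sub_self]
    have h2 : ((u⁻¹ : (H →L[ℂ] H)ˣ) : H →L[ℂ] H) ((u : H →L[ℂ] H) e) = e := by
      rw [← mul_apply_eq_comp, Units.inv_mul, one_apply_eq_self]
    rw [hu, h1, map_zero] at h2
    exact he h2.symm
  rw [funOp, cfc_apply f G hG hf.continuousOn]
  -- Both sides are continuous in `g` and respect sums and products, so Stone–Weierstrass reduces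
  -- the claim to constants and the identity.
  suffices h : ∀ g : C(spectrum ℝ G, ℝ), cfcHom hG g e = (g ⟨l, hmem⟩ : ℂ) • e from h _
  intro g
  have hid : cfcHom hG (ContinuousMap.restrict (spectrum ℝ G) (.id ℝ)) e = (l : ℂ) • e := by
    rw [cfcHom_id hG, hl]
  induction g using ContinuousMap.induction_on_of_compact with
  | const r =>
    have h : ContinuousMap.const (spectrum ℝ G) r = algebraMap ℝ C(spectrum ℝ G, ℝ) r := rfl
    rw [h, AlgHomClass.commutes, ContinuousLinearMap.algebraMap_apply, ← Complex.coe_smul]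
    rfl
  | id => exact hid
  | star_id => simpa using hid
  | add f g hf hg => simp [hf, hg, add_smul]
  | mul f g hf hg =>
    rw [map_mul, mul_apply_eq_comp, hg, map_smul, hf, smul_smul, ContinuousMap.mul_apply,
      Complex.ofReal_mul, mul_comm]
  | frequently f hf =>
    refine hf.mem_of_closed (isClosed_eq ?_ ?_)
    · exact (ContinuousLinearMap.apply ℂ H e).continuous.comp (cfcHom_continuous hG)
    · fun_prop

/-- The finite rank truncations `A s` agree with `T` on `eᵢ`, `i ∈ s`, so the Hilbert–Schmidt norm
of `T - A s` is the tail of a convergent series; `T` is their norm limit. -/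
theorem isCompactOperator_of_tsum {ι : Type*} (e : HilbertBasis ι ℂ H) (T : H →L[ℂ] H)
    (hT : ∑' i, ‖T (e i)‖ₑ ^ 2 ≠ ∞) : IsCompactOperator T := by
  classical
  let A : Finset ι → (H →L[ℂ] H) := fun s => ∑ i ∈ s, (innerSL ℂ (e i)).smulRight (T (e i))
  have hA : ∀ s, IsCompactOperator (A s) := fun s => by
    refine Submodule.sum_mem (compactOperator (RingHom.id ℂ) H H) fun i _ => ?_
    exact (isCompactOperator_id_iff_locallyCompactSpace.2 inferInstance :
      IsCompactOperator (id : ℂ → ℂ)).comp_clm (innerSL ℂ (e i)) |>.clm_comp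
        ((ContinuousLinearMap.id ℂ ℂ).smulRight (T (e i)))
  have hAe : ∀ s i, (T - A s) (e i) = if i ∈ s then 0 else T (e i) := fun s i => by
    simp only [A, sub_apply, sum_apply, ContinuousLinearMap.smulRight_apply,
      innerSL_apply_apply, orthonormal_iff_ite.1 e.orthonormal, ite_smul, one_smul, zero_smul,
      Finset.sum_ite_eq']
    split_ifs <;> simp
  have hlim : Tendsto A atTop (𝓝 T) := by
    have h1 : Tendsto (fun s : Finset ι => ∑' i : {i // i ∉ s}, ‖T (e i)‖ₑ ^ 2) atTop (𝓝 0) :=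
      ENNReal.tendsto_tsum_compl_atTop_zero hT
    rw [Metric.tendsto_nhds]
    intro ε hε
    have hε2 : (0 : ℝ≥0∞) < ENNReal.ofReal ((ε / 2) ^ 2) := by simp; positivity
    filter_upwards [h1.eventually (gt_mem_nhds hε2)] with s hs
    rw [dist_eq_norm, norm_sub_rev]
    refine lt_of_le_of_lt (ContinuousLinearMap.opNorm_le_bound _ (half_pos hε).le fun u => ?_)
      (half_lt_self hε)
    have h2 := enorm_apply_sq_le e (T - A s) u
    have h3 : ∑' i, ‖(T - A s) (e i)‖ₑ ^ 2 = ∑' i : {i // i ∉ s}, ‖T (e i)‖ₑ ^ 2 := by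
      have := tsum_subtype {i | i ∉ s} (fun i => ‖T (e i)‖ₑ ^ 2)
      refine Eq.trans (tsum_congr fun i => ?_) this.symm
      rw [hAe, Set.indicator_apply]
      by_cases hi : i ∈ s
      · simp [hi]
      · simp [hi]
    rw [h3] at h2
    have h4 := h2.trans (mul_le_mul_left hs.le (‖u‖ₑ ^ 2))
    rw [← ofReal_norm, ← ofReal_norm, ← ENNReal.ofReal_pow (norm_nonneg _),
      ← ENNReal.ofReal_pow (norm_nonneg _), ← ENNReal.ofReal_mul (by positivity),
      ENNReal.ofReal_le_ofReal_iff (by positivity), ← mul_pow] at h4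
    exact (abs_le_of_sq_le_sq' h4 (by positivity)).2
  exact isCompactOperator_of_tendsto hlim (Eventually.of_forall hA)

/-- Hilbert bases of all eigenspaces are glued, over every `z : ℂ`; those `z` that are not
eigenvalues contribute nothing. Completeness is the spectral theorem for compact symmetric
operators, and symmetry makes the occurring `z` real. -/
theorem exists_eigenbasis {H : Type u} [NormedAddCommGroup H] [InnerProductSpace ℂ H]
    [CompleteSpace H] {G : H →L[ℂ] H} (hG : G.IsPositive) (hc : IsCompactOperator G) :
    ∃ (ι : Type u) (e : HilbertBasis ι ℂ H) (l : ι → ℝ), ∀ i, G (e i) = (l i : ℂ) • e i := by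
  have hcl : ∀ z : ℂ, IsClosed (Module.End.eigenspace (G : H →ₗ[ℂ] H) z : Set H) := fun z => by
    have : (Module.End.eigenspace (G : H →ₗ[ℂ] H) z : Set H) = {x | G x = z • x} := by
      ext x; exact Module.End.mem_eigenspace_iff
    rw [this]
    exact isClosed_eq G.continuous (by fun_prop)
  have hcomp : ∀ z : ℂ, CompleteSpace (Module.End.eigenspace (G : H →ₗ[ℂ] H) z) := fun z =>
    (hcl z).completeSpace_coe
  choose w f hf using fun z : ℂ =>
    exists_hilbertBasis ℂ (Module.End.eigenspace (G : H →ₗ[ℂ] H) z)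
  have ho := (hG.isSymmetric.orthogonalFamily_eigenspaces).orthonormal_sigma_orthonormal
    fun z => (f z).orthonormal
  have hbot : (Submodule.span ℂ (Set.range fun a : Σ z, w z =>
      (Module.End.eigenspace (G : H →ₗ[ℂ] H) a.1).subtypeₗᵢ (f a.1 a.2)))ᗮ = ⊥ := by
    rw [eq_bot_iff, ← ContinuousLinearMap.orthogonalComplement_iSup_eigenspaces_eq_bot hc
      hG.isSymmetric, ← Submodule.iInf_orthogonal]
    intro x hx
    rw [Submodule.mem_iInf]
    intro z
    have h0 : (innerSL ℂ x).comp (Module.End.eigenspace (G : H →ₗ[ℂ] H) z).subtypeL = 0 := by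
      refine ContinuousLinearMap.ext_on
        (Submodule.dense_iff_topologicalClosure_eq_top.2 (f z).dense_span) ?_
      rintro _ ⟨i, rfl⟩
      exact (Submodule.mem_orthogonal' _ _).1 hx _ (Submodule.subset_span ⟨⟨z, i⟩, rfl⟩)
    rw [Submodule.mem_orthogonal']
    intro y hy
    exact DFunLike.congr_fun h0 ⟨y, hy⟩
  have he : ∀ i, HilbertBasis.mkOfOrthogonalEqBot ho hbot i = (f i.1 i.2 : H) := fun i => by
    rw [HilbertBasis.coe_mkOfOrthogonalEqBot]; rfl
  refine ⟨Σ z, w z, HilbertBasis.mkOfOrthogonalEqBot ho hbot, fun i => i.1.re, fun i => ?_⟩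
  have h1 : G (f i.1 i.2 : H) = i.1 • (f i.1 i.2 : H) :=
    Module.End.mem_eigenspace_iff.1 (f i.1 i.2).2
  have h2 : ‖(f i.1 i.2 : H)‖ = 1 := (f i.1).orthonormal.1 i.2
  have h3 := hG.isSymmetric (f i.1 i.2 : H) (f i.1 i.2 : H)
  rw [ContinuousLinearMap.coe_coe, h1, inner_smul_left, inner_smul_right,
    inner_self_eq_norm_sq_to_K, h2] at h3
  have h4 : ((i.1.re : ℝ) : ℂ) = i.1 := by
    rw [← Complex.conj_eq_iff_re]; simpa using h3
  rw [he, h1, h4]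

end FunctionalCalculus

/-! ### Convexity and lower semicontinuity of `Tr F(b, G)`. -/

section TraceFunction

theorem isCompactOperator_of_trace {G : Op} (hG : G.IsPositive) (h : trace G ≠ ∞) :
    IsCompactOperator G := by
  have h1 : IsCompactOperator (sqrtOp G) := by
    refine isCompactOperator_of_tsum basis _ ?_
    simp_rw [← re_inner_eq hG]
    exact h
  have h2 := h1.clm_comp (sqrtOp G)
  have h3 : (sqrtOp G : L2 → L2) ∘ sqrtOp G = G := by
    conv_rhs => rw [← sqrtOp_mul_self hG]
    rfl
  rwa [h3] at h2

theorem le_trace_FOp (b : ℝ) {ι : Type*} (e : HilbertBasis ι ℂ L2) {G : Op} (hG : G.IsPositive) :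
    ∑' i, ENNReal.ofReal (F b (RCLike.re (inner ℂ (e i) (G (e i))))) ≤ trace (FOp b G) := by
  rw [← traceIn_eq e (FOp_isPositive b G)]
  exact ENNReal.tsum_le_tsum fun i => ENNReal.ofReal_le_ofReal
    (le_inner_funOp hG (continuous_F b) (exists_subgradient_F b) (e.orthonormal.1 i))

/-- A positive operator with finite trace has a basis in which Peierls' inequality is sharp. -/
theorem exists_trace_FOp_eq {G : Op} (hG : G.IsPositive) (h : trace G ≠ ∞) :
    ∃ (ι : Type) (e : HilbertBasis ι ℂ L2), ∀ b,
      trace (FOp b G) = ∑' i, ENNReal.ofReal (F b (RCLike.re (inner ℂ (e i) (G (e i))))) := by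
  obtain ⟨ι, e, l, hl⟩ := exists_eigenbasis hG (isCompactOperator_of_trace hG h)
  refine ⟨ι, e, fun b => ?_⟩
  rw [← traceIn_eq e (FOp_isPositive b G), traceIn]
  have h1 : ∀ i (r : ℝ), RCLike.re (inner ℂ (e i) ((r : ℂ) • e i)) = r := fun i r => by
    rw [inner_smul_right, inner_self_eq_norm_sq_to_K, e.orthonormal.1 i]
    simp
  refine tsum_congr fun i => ?_
  have h2 : FOp b G (e i) = (F b (l i) : ℂ) • e i :=
    funOp_apply_eigenvector hG.isSelfAdjoint (continuous_F b) (e.orthonormal.ne_zero i) (hl i)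
  rw [h2, hl, h1, h1]

/-- In an eigenbasis of the limit, Peierls' inequality is an equality for `G` and an inequality for
every `Gn n`; the terms converge by continuity of `F`. -/
theorem trace_FOp_le_of_tendsto {U : Filter ℕ} [U.NeBot] {Gn : ℕ → Op} {G : Op}
    (hGn : ∀ n, (Gn n).IsPositive) (hG : G.IsPositive) (hT : trace G ≠ ∞)
    (h : FormTendsto U Gn G) (b : ℝ) {l : ℝ≥0∞}
    (hl : Tendsto (fun n => trace (FOp b (Gn n))) U (𝓝 l)) : trace (FOp b G) ≤ l := by
  obtain ⟨ι, e, he⟩ := exists_trace_FOp_eq hG hT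
  rw [he b, ENNReal.tsum_eq_iSup_sum]
  refine iSup_le fun s => le_of_tendsto_of_tendsto'
    (tendsto_finsetSum s fun j _ => ENNReal.tendsto_ofReal
      (((continuous_F b).tendsto _).comp (h (e j)))) hl fun n => ?_
  exact (ENNReal.sum_le_tsum s).trans (le_trace_FOp b e (hGn n))

/-- The eigenbasis of the midpoint reduces operator convexity under the trace to scalar convexity of
`F(b, ·)`. -/
theorem trace_FOp_midpoint_le (b : ℝ) {G₁ G₂ G : Op} (h₁ : G₁.IsPositive) (h₂ : G₂.IsPositive)
    (hG : G.IsPositive) (hT : trace G ≠ ∞)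
    (h : G = ((2⁻¹ : ℝ) : ℂ) • G₁ + ((2⁻¹ : ℝ) : ℂ) • G₂) :
    trace (FOp b G) ≤ 2⁻¹ * trace (FOp b G₁) + 2⁻¹ * trace (FOp b G₂) := by
  obtain ⟨ι, e, he⟩ := exists_trace_FOp_eq hG hT
  rw [he b]
  refine le_trans ?_ (add_le_add (mul_le_mul_right (le_trace_FOp b e h₁) _)
    (mul_le_mul_right (le_trace_FOp b e h₂) _))
  rw [← ENNReal.tsum_mul_left, ← ENNReal.tsum_mul_left, ← ENNReal.tsum_add]
  refine ENNReal.tsum_le_tsum fun i => ?_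
  have h2 : (2⁻¹ : ℝ≥0∞) = ENNReal.ofReal 2⁻¹ := by
    rw [ENNReal.ofReal_inv_of_pos two_pos]; simp
  rw [h2, ← ENNReal.ofReal_mul (by norm_num), ← ENNReal.ofReal_mul (by norm_num),
    ← ENNReal.ofReal_add (mul_nonneg (by norm_num) (F_nonneg _ _))
      (mul_nonneg (by norm_num) (F_nonneg _ _))]
  refine ENNReal.ofReal_le_ofReal (le_of_eq_of_le (congrArg (F b) ?_) (F_midpoint_le b _ _))
  rw [h, add_apply, FunLike.coe_smul, FunLike.coe_smul, Pi.smul_apply, Pi.smul_apply,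
    inner_add_right, inner_smul_right, inner_smul_right, map_add]
  simp only [RCLike.re_to_complex, Complex.re_ofReal_mul]

theorem trace_FOp_lt_top (b : ℝ) {G : Op} (hG : G.IsPositive) {ν : ℝ} (hν : 0 ≤ ν)
    (h : trace G = ENNReal.ofReal ν) : trace (FOp b G) < ∞ := by
  obtain ⟨ι, e, he⟩ := exists_trace_FOp_eq hG (h ▸ ENNReal.ofReal_ne_top)
  have hC : 0 ≤ Real.pi * ν + |b| / 2 := by positivity
  have h1 : trace (FOp b G) ≤ ENNReal.ofReal (Real.pi * ν + |b| / 2) * trace G := by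
    rw [he b, ← traceIn_eq e hG, traceIn, ← ENNReal.tsum_mul_left]
    refine ENNReal.tsum_le_tsum fun i => ?_
    rw [← ENNReal.ofReal_mul hC]
    refine ENNReal.ofReal_le_ofReal (F_le_linear b (hG.re_inner_nonneg_right _) ?_)
    have := re_inner_le_trace hG hν h (e i)
    rwa [e.orthonormal.1 i, one_pow, mul_one] at this
  rw [h] at h1
  exact h1.trans_lt (ENNReal.mul_lt_top ENNReal.ofReal_lt_top ENNReal.ofReal_lt_top)

end TraceFunction

/-! ### Weak compactness of bounded sets of positive operators. -/

section WeakLimit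

/-- Bounded sequences of positive operators converge weakly along ultrafilters. -/
theorem exists_weak_limit {H : Type*} [NormedAddCommGroup H] [InnerProductSpace ℂ H]
    [CompleteSpace H] (U : Ultrafilter ℕ) {Gn : ℕ → H →L[ℂ] H} (hGn : ∀ n, (Gn n).IsPositive)
    {C : ℝ} (hC : ∀ n, ‖Gn n‖ ≤ C) :
    ∃ G : H →L[ℂ] H, G.IsPositive ∧ ∀ u : H, Tendsto (fun n => RCLike.re (inner ℂ u (Gn n u))) U
      (𝓝 (RCLike.re (inner ℂ u (G u)))) := by
  have hb : ∀ u v n, ‖inner ℂ (Gn n u) v‖ ≤ C * ‖u‖ * ‖v‖ := fun u v n =>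
    (norm_inner_le_norm _ _).trans (mul_le_mul_of_nonneg_right
      (((Gn n).le_opNorm u).trans (mul_le_mul_of_nonneg_right (hC n) (norm_nonneg _)))
      (norm_nonneg _))
  have hex : ∀ u v, ∃ z, Tendsto (fun n => inner ℂ (Gn n u) v) U (𝓝 z) := fun u v => by
    obtain ⟨z, -, hz⟩ := (isCompact_closedBall (0 : ℂ) (C * ‖u‖ * ‖v‖)).ultrafilter_le_nhds
      (U.map fun n => inner ℂ (Gn n u) v) 
      (tendsto_principal.2 (Eventually.of_forall fun n => mem_closedBall_zero_iff.2 (hb u v n)))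
    exact ⟨z, hz⟩
  choose L hL using hex
  -- The limits inherit sesquilinearity and the bound `C`, so Riesz representation turns them into
  -- an operator.
  let B : H →ₗ⋆[ℂ] H →ₗ[ℂ] ℂ := LinearMap.mk₂'ₛₗ (starRingEnd ℂ) (RingHom.id ℂ) L
    (fun u u' v => tendsto_nhds_unique (hL _ _) (by
      simpa only [map_add, inner_add_left] using (hL u v).add (hL u' v)))
    (fun c u v => tendsto_nhds_unique (hL _ _) (by
      simpa only [map_smul, inner_smul_left] using! (hL u v).const_mul (starRingEnd ℂ c)))
    (fun u v v' => tendsto_nhds_unique (hL _ _) (by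
      simpa only [inner_add_right] using (hL u v).add (hL u v')))
    (fun c u v => tendsto_nhds_unique (hL _ _) (by
      simpa only [inner_smul_right] using! (hL u v).const_mul c))
  let G : H →L[ℂ] H := InnerProductSpace.continuousLinearMapOfBilin (B.mkContinuous₂ C
    fun u v => le_of_tendsto (hL u v).norm (Eventually.of_forall (hb u v)))
  have hG : ∀ u v, inner ℂ (G u) v = L u v := fun u v =>
    InnerProductSpace.continuousLinearMapOfBilin_apply _ u v
  have hpos : G.IsPositive := by
    rw [ContinuousLinearMap.isPositive_iff_complex]
    intro u
    have h1 := hL u u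
    rw [← hG] at h1
    have h2 : ∀ n, ((RCLike.re (inner ℂ (Gn n u) u) : ℝ) : ℂ) = inner ℂ (Gn n u) u := fun n =>
      ((ContinuousLinearMap.isPositive_iff_complex _).1 (hGn n) u).1
    have h3 := (Complex.continuous_re.tendsto _).comp h1
    refine ⟨tendsto_nhds_unique (((Complex.continuous_ofReal.tendsto _).comp h3).congr h2) h1,
      ge_of_tendsto h3 (Eventually.of_forall fun n =>
        ((ContinuousLinearMap.isPositive_iff_complex _).1 (hGn n) u).2)⟩
  refine ⟨G, hpos, fun u => ?_⟩
  have h1 := (Complex.continuous_re.tendsto _).comp (hL u u)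
  rw [← hG] at h1
  rw [inner_re_symm]
  exact h1.congr fun n => inner_re_symm _ _

end WeakLimit

/-! ### Phase space localization is Hilbert–Schmidt. -/

section Localization

/-- The `L²` transform is known through its action on tempered distributions; testing with smooth
compactly supported functions and the multiplication formula identify it with the Fourier integral.
-/
theorem fourierOp_coe_ae_eq (u : L2) (hu : Integrable u) :
    (fourierOp u : ℝ → ℂ) =ᵐ[volume] 𝓕 (u : ℝ → ℂ) := by
  have hcont : Continuous (𝓕 (u : ℝ → ℂ)) :=
    VectorFourier.fourierIntegral_continuous Real.continuous_fourierChar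
      (by exact continuous_inner) hu
  refine ae_eq_of_integral_contDiff_smul_eq
    ((Lp.memLp (fourierOp u)).locallyIntegrable (by norm_num)) hcont.locallyIntegrable
    fun g hg hgs => ?_
  have hgs' : HasCompactSupport (fun x => (g x : ℂ)) := hgs.comp_left Complex.ofReal_zero
  let φ : SchwartzMap ℝ ℂ := hgs'.toSchwartzMap (Complex.ofRealCLM.contDiff.comp hg)
  have h1 := DFunLike.congr_fun (Lp.fourier_toTemperedDistribution_eq u) φ
  rw [TemperedDistribution.fourier_apply, Lp.toTemperedDistribution_apply,
    Lp.toTemperedDistribution_apply] at h1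
  have h2 : ∫ ξ, (𝓕 (φ : ℝ → ℂ)) ξ • u ξ = ∫ x, φ x • 𝓕 (u : ℝ → ℂ) x := by
    have h := VectorFourier.integral_fourierIntegral_smul_eq_flip (μ := volume) (ν := volume)
      (L := innerₗ ℝ) Real.continuous_fourierChar (by exact continuous_inner) φ.integrable hu
    rwa [flip_innerₗ] at h
  have h3 : ∫ x, φ x • (fourierOp u : ℝ → ℂ) x = ∫ x, φ x • 𝓕 (u : ℝ → ℂ) x := h1.symm.trans h2
  exact h3

/-- Multiplication by the indicator function of a set, as a linear map. -/
def indicatorLM (s : Set ℝ) (hs : MeasurableSet s) : L2 →ₗ[ℂ] L2 where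
  toFun u := ((Lp.memLp u).indicator hs).toLp (s.indicator u)
  map_add' u v := by
    rw [← MemLp.toLp_add]
    refine MemLp.toLp_congr _ _ ?_
    rw [← Set.indicator_add']
    exact (Lp.coeFn_add u v).indicator
  map_smul' c u := by
    rw [RingHom.id_apply, ← MemLp.toLp_const_smul]
    refine MemLp.toLp_congr _ _ ?_
    have h : c • s.indicator (u : ℝ → ℂ) = s.indicator (c • (u : ℝ → ℂ)) :=
      (Set.indicator_const_smul s c _).symm
    rw [h]
    exact (Lp.coeFn_smul c u).indicator

theorem indicatorLM_coe_ae_eq (s : Set ℝ) (hs : MeasurableSet s) (u : L2) :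
    (indicatorLM s hs u : ℝ → ℂ) =ᵐ[volume] s.indicator u := by
  have h : indicatorLM s hs u = ((Lp.memLp u).indicator hs).toLp (s.indicator u) := rfl
  rw [h]
  exact MemLp.coeFn_toLp _

theorem norm_indicatorLM_le (s : Set ℝ) (hs : MeasurableSet s) (u : L2) :
    ‖indicatorLM s hs u‖ ≤ 1 * ‖u‖ := by
  rw [one_mul, Lp.norm_def, Lp.norm_def, eLpNorm_congr_ae (indicatorLM_coe_ae_eq s hs u)]
  exact ENNReal.toReal_mono (Lp.eLpNorm_ne_top u) (eLpNorm_indicator_le _)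

/-- Multiplication by the indicator function of a set. -/
def indicatorOp (s : Set ℝ) (hs : MeasurableSet s) : Op :=
  (indicatorLM s hs).mkContinuous 1 (norm_indicatorLM_le s hs)

theorem indicatorOp_coe_ae_eq (s : Set ℝ) (hs : MeasurableSet s) (u : L2) :
    (indicatorOp s hs u : ℝ → ℂ) =ᵐ[volume] s.indicator u :=
  indicatorLM_coe_ae_eq s hs u

theorem integrable_indicatorOp {s : Set ℝ} (hs : MeasurableSet s) (hsv : volume s ≠ ∞) (u : L2) :
    Integrable (indicatorOp s hs u : ℝ → ℂ) := by
  have : IsFiniteMeasure (volume.restrict s) := ⟨by simpa using hsv.lt_top⟩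
  refine (integrable_congr (indicatorOp_coe_ae_eq s hs u)).2 ((integrable_indicator_iff hs).2 ?_)
  exact ((Lp.memLp u).restrict s).integrable (by norm_num)

/-- The localization `1_t(-i∇) 1_s(x)` in phase space. -/
def localizationOp (s t : Set ℝ) (hs : MeasurableSet s) :
    L2 →L[ℂ] Lp ℂ 2 (volume.restrict t : Measure ℝ) :=
  LpToLpRestrictCLM ℝ ℂ ℂ volume 2 t ∘L (fourierOp ∘L indicatorOp s hs)

/-- At fixed `ξ` the Fourier integral of `1_s eᵢ` is the inner product of `eᵢ` with a plane wave cut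
off to `s`, whose squared norm is `|s|`; Parseval sums these coefficients. -/
theorem tsum_enorm_fourier_indicatorOp {s : Set ℝ} (hs : MeasurableSet s) (hsv : volume s ≠ ∞)
    (ξ : ℝ) : ∑' i, ‖𝓕 (indicatorOp s hs (basis i) : ℝ → ℂ) ξ‖ₑ ^ 2 = volume s := by
  have hm : MemLp (s.indicator fun x : ℝ => ((Real.fourierChar (x * ξ) : Circle) : ℂ)) 2 := by
    refine (memLp_indicator_const 2 hs (1 : ℂ) (Or.inr hsv)).of_le ?_ ?_
    · exact (Continuous.aestronglyMeasurable (by fun_prop)).indicator hs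
    · refine Eventually.of_forall fun x => ?_
      by_cases h : x ∈ s <;> simp [h, Circle.norm_coe]
  have h1 : ∀ i, 𝓕 (indicatorOp s hs (basis i) : ℝ → ℂ) ξ = inner ℂ (hm.toLp _) (basis i) :=
    fun i => by
      rw [L2.inner_def, Real.fourier_real_eq]
      refine integral_congr_ae ?_
      filter_upwards [indicatorOp_coe_ae_eq s hs (basis i), hm.coeFn_toLp] with x h2 h3
      rw [h2, h3]
      by_cases h : x ∈ s
      · simp [h, Circle.smul_def, mul_comm, AddChar.map_neg_eq_inv]
      · simp [h]
  have h2 := parseval basis (hm.toLp _)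
  rw [enorm_sq_eq_lintegral] at h2
  calc _ = ∑' i, ‖inner ℂ (basis i) (hm.toLp _)‖ₑ ^ 2 := tsum_congr fun i => by
        rw [h1, ← inner_conj_symm, ← ofReal_norm, ← ofReal_norm, RCLike.norm_conj]
    _ = ∫⁻ x, s.indicator 1 x := by
        rw [← h2]
        refine lintegral_congr_ae ?_
        filter_upwards [hm.coeFn_toLp] with x hx
        rw [hx]
        by_cases h : x ∈ s <;> simp [h, ← ofReal_norm, Circle.norm_coe]
    _ = volume s := by simp [lintegral_indicator hs]

theorem tsum_enorm_localizationOp {s t : Set ℝ} (hs : MeasurableSet s) (hsv : volume s ≠ ∞) :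
    ∑' i, ‖localizationOp s t hs (basis i)‖ₑ ^ 2 = volume s * volume t := by
  have := countable_index basis
  rw [localizationOp, ← setLIntegral_tsum basis (fourierOp ∘L indicatorOp s hs) t]
  have h : ∀ᵐ ξ, ∑' i, ‖((fourierOp ∘L indicatorOp s hs) (basis i) : L2) ξ‖ₑ ^ 2 = volume s := by
    -- Countability of the basis allows one null set for all `i`.
    have h1 : ∀ᵐ ξ, ∀ i, (fourierOp (indicatorOp s hs (basis i)) : L2) ξ =
        𝓕 (indicatorOp s hs (basis i) : ℝ → ℂ) ξ :=
      ae_all_iff.2 fun i => fourierOp_coe_ae_eq _ (integrable_indicatorOp hs hsv _)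
    filter_upwards [h1] with ξ hξ
    rw [← tsum_enorm_fourier_indicatorOp hs hsv ξ]
    exact tsum_congr fun i => by rw [ContinuousLinearMap.comp_apply, hξ i]
  rw [lintegral_congr_ae (ae_restrict_of_ae h), setLIntegral_const]

theorem enorm_fourierOp (u : L2) : ‖fourierOp u‖ₑ = ‖u‖ₑ := by
  rw [← ofReal_norm, ← ofReal_norm]
  exact congrArg _ ((Lp.fourierTransformₗᵢ ℝ ℂ).norm_map u)

theorem enorm_restrict_sq (t : Set ℝ) (u : L2) :
    ‖LpToLpRestrictCLM ℝ ℂ ℂ volume 2 t u‖ₑ ^ 2 = ∫⁻ x in t, ‖u x‖ₑ ^ 2 := by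
  rw [enorm_sq_eq_lintegral]
  refine lintegral_congr_ae ?_
  filter_upwards [LpToLpRestrictCLM_coeFn ℂ t u] with x hx
  rw [hx]

theorem enorm_restrict_sq_add_compl {t : Set ℝ} (ht : MeasurableSet t) (u : L2) :
    ‖LpToLpRestrictCLM ℝ ℂ ℂ volume 2 t u‖ₑ ^ 2 +
      ‖LpToLpRestrictCLM ℝ ℂ ℂ volume 2 tᶜ u‖ₑ ^ 2 = ‖u‖ₑ ^ 2 := by
  rw [enorm_restrict_sq, enorm_restrict_sq, enorm_sq_eq_lintegral, lintegral_add_compl _ ht]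

theorem enorm_add_sq_le {E : Type*} [NormedAddCommGroup E] (u v : E) :
    ‖u + v‖ₑ ^ 2 ≤ 2 * ‖u‖ₑ ^ 2 + 2 * ‖v‖ₑ ^ 2 := by
  have h : ‖u + v‖ ^ 2 ≤ 2 * ‖u‖ ^ 2 + 2 * ‖v‖ ^ 2 := by
    nlinarith [norm_add_le u v, norm_nonneg (u + v), sq_nonneg (‖u‖ - ‖v‖)]
  have h2 := ENNReal.ofReal_le_ofReal h
  rw [ENNReal.ofReal_add (by positivity) (by positivity), ENNReal.ofReal_mul (by norm_num),
    ENNReal.ofReal_mul (by norm_num)] at h2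
  simpa [ENNReal.ofReal_pow, ofReal_norm] using h2

/-- The part of `u` outside of the phase space region `s × t` is controlled by the tails of `u`
and of its Fourier transform. -/
theorem enorm_sq_le_localization {s t : Set ℝ} (hs : MeasurableSet s) (ht : MeasurableSet t)
    (u : L2) : ‖u‖ₑ ^ 2 ≤ ‖localizationOp s t hs u‖ₑ ^ 2 +
      (3 * ‖LpToLpRestrictCLM ℝ ℂ ℂ volume 2 sᶜ u‖ₑ ^ 2 +
        2 * ‖LpToLpRestrictCLM ℝ ℂ ℂ volume 2 tᶜ (fourierOp u)‖ₑ ^ 2) := by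
  set R := LpToLpRestrictCLM ℝ ℂ ℂ (volume : Measure ℝ) 2 tᶜ with hR
  set v := indicatorOp s hs u with hv
  have h1 : ‖u‖ₑ ^ 2 = ‖v‖ₑ ^ 2 + ‖LpToLpRestrictCLM ℝ ℂ ℂ volume 2 sᶜ u‖ₑ ^ 2 := by
    rw [← enorm_restrict_sq_add_compl hs u]
    congr 1
    rw [enorm_restrict_sq, enorm_sq_eq_lintegral, ← lintegral_indicator hs]
    refine lintegral_congr_ae ?_
    filter_upwards [indicatorOp_coe_ae_eq s hs u] with x hx
    rw [hv, hx]
    by_cases h : x ∈ s <;> simp [h]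
  have h2 : ‖u - v‖ₑ ^ 2 = ‖LpToLpRestrictCLM ℝ ℂ ℂ volume 2 sᶜ u‖ₑ ^ 2 := by
    rw [enorm_restrict_sq, enorm_sq_eq_lintegral, ← lintegral_indicator hs.compl]
    refine lintegral_congr_ae ?_
    filter_upwards [indicatorOp_coe_ae_eq s hs u, Lp.coeFn_sub u v] with x hx hx'
    rw [hx', Pi.sub_apply, hv, hx]
    by_cases h : x ∈ s <;> simp [h]
  have h3 : ‖v‖ₑ ^ 2 = ‖localizationOp s t hs u‖ₑ ^ 2 + ‖R (fourierOp v)‖ₑ ^ 2 := by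
    rw [← enorm_fourierOp v, ← enorm_restrict_sq_add_compl ht (fourierOp v)]
    rfl
  -- Replacing `v = 1_s u` by `u` in the momentum tail costs twice the position tail; with the
  -- position tail in `h1` this gives the constant `3`.
  have h4 : ‖R (fourierOp v)‖ₑ ^ 2 ≤ 2 * ‖R (fourierOp u)‖ₑ ^ 2 +
      2 * ‖LpToLpRestrictCLM ℝ ℂ ℂ volume 2 sᶜ u‖ₑ ^ 2 := by
    have h5 : R (fourierOp v) = R (fourierOp u) + R (fourierOp (v - u)) := by
      rw [← map_add, ← map_add]; simp
    rw [h5, ← h2]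
    refine (enorm_add_sq_le _ _).trans (add_le_add_right (mul_le_mul_right ?_ _) _)
    rw [← neg_sub v u, enorm_neg, ← enorm_fourierOp (v - u),
      ← enorm_restrict_sq_add_compl ht (fourierOp (v - u))]
    exact le_add_self
  rw [h1, h3, add_assoc]
  refine add_le_add_right ((add_le_add_left h4 _).trans (le_of_eq ?_)) _
  ring

end Localization

/-! ### Distribution functions and the Hartree term. -/

section Primitive

theorem continuous_integral_Iic {f : ℝ → ℝ} (hf : Integrable f) : Continuous (primitive f) := by
  refine continuous_iff_continuousAt.2 fun x => ?_
  exact (IntegrableOn.continuousOn_Iic_primitive_Iic (a₀ := x + 1)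
    hf.integrableOn).continuousAt (Iic_mem_nhds (lt_add_one x))

/-- The measure `ρ_G(x) dx`. -/
def posMeasure (G : Op) : Measure ℝ := massMeasure (ContinuousLinearMap.id ℂ L2) G

theorem posMeasure_univ {G : Op} (hG : G.IsPositive) : posMeasure G Set.univ = trace G := by
  rw [posMeasure, ← densityIn_lintegral_eq G _ MeasurableSet.univ, Measure.restrict_univ,
    lintegral_densityIn basis hG]

theorem aemeasurable_densityIn (G : Op) : AEMeasurable (densityIn basis G) :=
  aemeasurable_massDensity (ContinuousLinearMap.id ℂ L2) G

theorem integrable_density {G : Op} (hG : G.IsPositive) (hT : trace G ≠ ∞) :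
    Integrable (density G) :=
  integrable_toReal_of_lintegral_ne_top (aemeasurable_densityIn G)
    (by rwa [lintegral_densityIn basis hG])

/-- The distribution function `x ↦ ∫_{-∞}^x ρ_G`. -/
def distrib (G : Op) (x : ℝ) : ℝ := (posMeasure G (Set.Iic x)).toReal

theorem distrib_nonneg (G : Op) (x : ℝ) : 0 ≤ distrib G x := ENNReal.toReal_nonneg

theorem primitive_density {G : Op} (hG : G.IsPositive) (hT : trace G ≠ ∞) :
    primitive (density G) = distrib G := by
  ext x
  rw [distrib, posMeasure, ← densityIn_lintegral_eq G _ measurableSet_Iic, primitive]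
  refine integral_toReal (aemeasurable_densityIn G).restrict (ae_restrict_of_ae ?_)
  exact ae_lt_top' (aemeasurable_densityIn G) (by rwa [lintegral_densityIn basis hG])

theorem primitive_density_sub {G : Op} (hG : G.IsPositive) (hT : trace G ≠ ∞) {μ : ℝ → ℝ}
    (hμ : Integrable μ) (x : ℝ) :
    primitive (fun x => density G x - μ x) x = distrib G x - primitive μ x := by
  rw [← primitive_density hG hT, primitive, integral_sub (integrable_density hG hT).integrableOn
    hμ.integrableOn]
  rfl

theorem continuous_distrib {G : Op} (hG : G.IsPositive) (hT : trace G ≠ ∞) :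
    Continuous (distrib G) := by
  rw [← primitive_density hG hT]
  exact continuous_integral_Iic (integrable_density hG hT)

theorem posMeasure_ne_top {G : Op} (hG : G.IsPositive) (hT : trace G ≠ ∞) (s : Set ℝ) :
    posMeasure G s ≠ ∞ :=
  ((measure_mono (Set.subset_univ s)).trans_lt ((posMeasure_univ hG).trans_lt hT.lt_top)).ne

theorem monotone_distrib {G : Op} (hG : G.IsPositive) (hT : trace G ≠ ∞) :
    Monotone (distrib G) := fun _ _ h =>
  ENNReal.toReal_mono (posMeasure_ne_top hG hT _) (measure_mono (Set.Iic_subset_Iic.2 h))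

theorem hartree_density_sub {G : Op} (hG : G.IsPositive) (hT : trace G ≠ ∞) {μ : ℝ → ℝ}
    (hμ : Integrable μ) : hartree (fun x => density G x - μ x) =
      ENNReal.ofReal (4 * Real.pi) * ∫⁻ x, ‖distrib G x - primitive μ x‖ₑ ^ 2 := by
  simp_rw [hartree, primitive_density_sub hG hT hμ]

theorem tendsto_primitive_atBot (f : ℝ → ℝ) :
    Tendsto (primitive f) atBot (𝓝 0) :=
  tendsto_integral_Iic_zero tendsto_id

theorem tendsto_primitive_atTop {f : ℝ → ℝ} (hf : Integrable f) :
    Tendsto (primitive f) atTop (𝓝 (∫ x, f x)) :=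
  (aecover_Iic tendsto_id).integral_tendsto_of_countably_generated hf

theorem monotone_primitive {f : ℝ → ℝ} (hf : Integrable f) (h0 : ∀ᵐ x, 0 ≤ f x) :
    Monotone (primitive f) := fun _ _ h =>
  setIntegral_mono_set hf.integrableOn (ae_restrict_of_ae h0)
    (Set.Iic_subset_Iic.2 h).eventuallyLE

end Primitive

/-! ### Tightness in phase space and conservation of mass. -/

section Tightness

theorem ofReal_mul_le_lintegral_sq {w : ℝ → ℝ} {a L δ : ℝ} (hδ : 0 ≤ δ)
    (h : ∀ x ∈ Set.Icc a (a + L), δ ≤ |w x|) :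
    ENNReal.ofReal (δ ^ 2 * L) ≤ ∫⁻ x, ‖w x‖ₑ ^ 2 := by
  calc ENNReal.ofReal (δ ^ 2 * L) = ∫⁻ _ in Set.Icc a (a + L), ENNReal.ofReal (δ ^ 2) := by
        rw [setLIntegral_const, Real.volume_Icc, add_sub_cancel_left,
          ENNReal.ofReal_mul (sq_nonneg _)]
    _ ≤ ∫⁻ x in Set.Icc a (a + L), ‖w x‖ₑ ^ 2 := by
        refine setLIntegral_mono' measurableSet_Icc fun x hx => ?_
        rw [ENNReal.ofReal_pow hδ, ← ofReal_norm, Real.norm_eq_abs]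
        exact pow_le_pow_left' (ENNReal.ofReal_le_ofReal (h x hx)) 2
    _ ≤ _ := setLIntegral_le_lintegral _ _

/-- States with bounded Hartree energy are uniformly concentrated on bounded intervals. -/
theorem exists_posMeasure_compl_le {μ : ℝ → ℝ} (hμ : Integrable μ) {K : ℝ≥0∞} (hK : K ≠ ∞) {ε : ℝ}
    (hε : 0 < ε) : ∃ R : ℝ, ∀ G ∈ states (∫ x, μ x),
      hartree (fun x => density G x - μ x) ≤ K →
      posMeasure G (Set.Icc (-R) R)ᶜ ≤ ENNReal.ofReal ε := by
  set δ := ε / 4 with hδ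
  have hδ0 : 0 < δ := by positivity
  obtain ⟨R₁, h₁⟩ := eventually_atBot.1
    ((tendsto_primitive_atBot μ).eventually (gt_mem_nhds hδ0))
  obtain ⟨R₂, h₂⟩ := eventually_atTop.1
    ((tendsto_primitive_atTop hμ).eventually (lt_mem_nhds (sub_lt_self (∫ x, μ x) hδ0)))
  -- The length for which `|W| ≥ δ` on an interval of length `L` already contradicts the bound `K`.
  set L := K.toReal / (4 * Real.pi * δ ^ 2) + 1 with hL
  have hL0 : 0 < L := by positivity
  have hLK : K < ENNReal.ofReal (4 * Real.pi) * ENNReal.ofReal (δ ^ 2 * L) := by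
    rw [← ENNReal.ofReal_mul (by positivity), ENNReal.lt_ofReal_iff_toReal_lt hK]
    have h : 4 * Real.pi * (δ ^ 2 * L) = K.toReal + 4 * Real.pi * δ ^ 2 := by
      rw [hL]; field_simp
    rw [h]
    have : 0 < 4 * Real.pi * δ ^ 2 := by positivity
    linarith
  -- This makes `W_μ < δ` on `[-R, -R + L]` and `W_μ > ν - δ` on `[R - L, R]`.
  set R := max (L - R₁) (R₂ + L) with hR
  refine ⟨R, fun G hG hGK => ?_⟩
  have hT : trace G ≠ ∞ := hG.2 ▸ ENNReal.ofReal_ne_top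
  rw [hartree_density_sub hG.1 hT hμ] at hGK
  have hmono := monotone_distrib hG.1 hT
  have key : ∀ a, (∀ x ∈ Set.Icc a (a + L), δ ≤ |distrib G x - primitive μ x|) → False :=
    fun a ha => not_lt_of_ge hGK (hLK.trans_le
      (mul_le_mul_right (ofReal_mul_le_lintegral_sq hδ0.le ha) _))
  -- By monotonicity a value above `2δ` at `-R` persists on the whole interval to its right, where
  -- `W_μ < δ`. The right end is symmetric, and the two tails add up to `4δ = ε`.
  have hl : distrib G (-R) ≤ 2 * δ := by
    by_contra! hlt
    refine key (-R) fun x hx => ?_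
    have h3 : primitive μ x < δ := h₁ x (by linarith [hx.2, le_max_left (L - R₁) (R₂ + L)])
    exact le_trans (by linarith [hmono hx.1]) (le_abs_self _)
  have hr : (∫ x, μ x) - 2 * δ ≤ distrib G R := by
    by_contra! hlt
    refine key (R - L) fun x hx => ?_
    have h3 := h₂ x (by linarith [hx.1, le_max_right (L - R₁) (R₂ + L)])
    have h4 : distrib G x ≤ distrib G R := hmono (by linarith [hx.2])
    exact le_trans (by linarith) (neg_le_abs _)
  have hsub : (Set.Icc (-R) R)ᶜ ⊆ Set.Iic (-R) ∪ (Set.Iic R)ᶜ := fun x hx => by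
    by_contra hx'
    simp only [Set.mem_union, Set.mem_Iic, Set.mem_compl_iff, not_or, not_le, not_lt] at hx'
    exact hx ⟨hx'.1.le, hx'.2⟩
  have hc : posMeasure G (Set.Iic R)ᶜ = ENNReal.ofReal (∫ x, μ x) - posMeasure G (Set.Iic R) := by
    rw [measure_compl measurableSet_Iic (posMeasure_ne_top hG.1 hT _), posMeasure_univ hG.1, hG.2]
  have ho : ∀ x, posMeasure G (Set.Iic x) = ENNReal.ofReal (distrib G x) := fun x =>
    (ENNReal.ofReal_toReal (posMeasure_ne_top hG.1 hT _)).symm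
  refine (measure_mono hsub).trans ((measure_union_le _ _).trans ?_)
  rw [hc, ho, ho, ← ENNReal.ofReal_sub _ (distrib_nonneg G R)]
  refine (add_le_add (ENNReal.ofReal_le_ofReal hl)
    (ENNReal.ofReal_le_ofReal (q := 2 * δ) (by linarith))).trans (le_of_eq ?_)
  rw [← ENNReal.ofReal_add (by positivity) (by positivity)]
  congr 1
  ring

theorem enorm_localizationOp_le {s t : Set ℝ} (hs : MeasurableSet s) (ht : MeasurableSet t)
    (u : L2) : ‖localizationOp s t hs u‖ₑ ≤ ‖u‖ₑ := by
  have h1 : ‖localizationOp s t hs u‖ₑ ^ 2 ≤ ‖fourierOp (indicatorOp s hs u)‖ₑ ^ 2 := by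
    rw [← enorm_restrict_sq_add_compl ht (fourierOp (indicatorOp s hs u))]
    exact le_self_add
  have h2 : ‖indicatorOp s hs u‖ₑ ≤ ‖u‖ₑ := by
    rw [← ofReal_norm, ← ofReal_norm]
    refine ENNReal.ofReal_le_ofReal ?_
    have := norm_indicatorLM_le s hs u
    rwa [one_mul] at this
  rw [enorm_fourierOp] at h1
  exact ((ENNReal.pow_le_pow_left_iff two_ne_zero).1 h1).trans h2

/-- Chebyshev's inequality with the weight `(2πξ)²`. -/
theorem momMeasure_compl_le (G : Op) {M : ℝ} (hM : 0 < M) :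
    massMeasure fourierOp G (Set.Icc (-M) M)ᶜ ≤
      traceLaplace G / ENNReal.ofReal ((2 * Real.pi * M) ^ 2) := by
  rw [ENNReal.le_div_iff_mul_le (Or.inl (by simp; positivity)) (Or.inl ENNReal.ofReal_ne_top),
    mul_comm, traceLaplace_eq_lintegral, ← setLIntegral_const]
  refine (setLIntegral_mono' measurableSet_Icc.compl fun ξ hξ => ?_).trans
    (setLIntegral_le_lintegral _ _)
  refine ENNReal.ofReal_le_ofReal ?_
  have h : M ≤ |ξ| := by
    by_contra! h
    exact hξ (abs_le.1 h.le)
  rw [mul_pow, mul_pow _ ξ, ← sq_abs ξ]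
  gcongr

theorem trace_le_localization {G : Op} (hG : G.IsPositive) {s t : Set ℝ} (hs : MeasurableSet s)
    (ht : MeasurableSet t) : trace G ≤ hsSq (localizationOp s t hs) G +
      (3 * posMeasure G sᶜ + 2 * massMeasure fourierOp G tᶜ) := by
  rw [trace_eq_hsSq hG, posMeasure, massMeasure_apply _ _ hs.compl, massMeasure_apply _ _ ht.compl]
  simp_rw [hsSq]
  rw [← ENNReal.tsum_mul_left, ← ENNReal.tsum_mul_left, ← ENNReal.tsum_add, ← ENNReal.tsum_add]
  exact ENNReal.tsum_le_tsum fun i => enorm_sq_le_localization hs ht _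

theorem hsSq_localizationOp_le {G : Op} (hG : G.IsPositive) {s t : Set ℝ} (hs : MeasurableSet s)
    (ht : MeasurableSet t) : hsSq (localizationOp s t hs) G ≤ trace G := by
  rw [trace_eq_hsSq hG]
  exact ENNReal.tsum_le_tsum fun i => pow_le_pow_left' (enorm_localizationOp_le hs ht _) 2

/-- No mass is lost in the weak limit of a tight sequence with bounded kinetic energy. -/
theorem trace_eq_of_formTendsto {U : Filter ℕ} [U.NeBot] {Gn : ℕ → Op} {G : Op} {ν : ℝ}
    (hν : 0 ≤ ν) (hGn : ∀ n, Gn n ∈ states ν) (hG : G.IsPositive) (h : FormTendsto U Gn G)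
    {K : ℝ≥0∞} (hK : K ≠ ∞) (hkin : ∀ n, traceLaplace (Gn n) ≤ K)
    (htight : ∀ ε : ℝ, 0 < ε → ∃ R : ℝ, ∀ n, posMeasure (Gn n) (Set.Icc (-R) R)ᶜ ≤
      ENNReal.ofReal ε) : trace G = ENNReal.ofReal ν := by
  have hpos := fun n => (hGn n).1
  have htr := fun n => (hGn n).2
  refine le_antisymm ?_ ?_
  · rw [trace_eq_hsSq hG]
    refine hsSq_le_of_tendsto hpos hG h _ (tendsto_const_nhds.congr fun n => ?_)
    rw [← trace_eq_hsSq (hpos n), htr n]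
  · refine ENNReal.le_of_forall_pos_le_add fun ε hε _ => ?_
    -- The tails enter with the weights `3` and `2`.
    have hε' : (0 : ℝ) < ε / 5 := by positivity
    obtain ⟨R, hR⟩ := htight (ε / 5) hε'
    obtain ⟨M, hM0, hM⟩ : ∃ M : ℝ, 0 < M ∧
        K / ENNReal.ofReal ((2 * Real.pi * M) ^ 2) ≤ ENNReal.ofReal (ε / 5) := by
      -- It suffices that `M - 1 = 5K/ε` is at most `(2πM)²`, which holds because `M ≥ 1`.
      refine ⟨5 * K.toReal / ε + 1, by positivity, ENNReal.div_le_of_le_mul ?_⟩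
      rw [← ENNReal.ofReal_mul hε'.le, ← ENNReal.ofReal_toReal hK]
      refine ENNReal.ofReal_le_ofReal ?_
      rw [ENNReal.toReal_ofReal ENNReal.toReal_nonneg]
      set k := K.toReal
      have hε0 : (0 : ℝ) < ε := hε
      have hk : 0 ≤ k := ENNReal.toReal_nonneg
      set M := 5 * k / ε + 1 with hM
      have hM1 : 1 ≤ M := by
        rw [hM]
        exact le_add_of_nonneg_left (by positivity)
      have h1 : k = ε / 5 * (M - 1) := by rw [hM]; field_simp; ring
      have h2 : M - 1 ≤ (2 * Real.pi * M) ^ 2 := by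
        have h3 : M ≤ 2 * Real.pi * M := by nlinarith [Real.pi_gt_three]
        nlinarith
      rw [h1]
      exact mul_le_mul_of_nonneg_left h2 hε'.le
    have hb : ∀ n, ENNReal.ofReal ν ≤ hsSq (localizationOp (Set.Icc (-R) R) (Set.Icc (-M) M)
        measurableSet_Icc) (Gn n) + ε := fun n => by
      rw [← htr n]
      refine (trace_le_localization (hpos n) measurableSet_Icc measurableSet_Icc).trans
        (add_le_add_right ((add_le_add (mul_le_mul_right (hR n) 3) (mul_le_mul_right
          ((momMeasure_compl_le (Gn n) hM0).trans ((ENNReal.div_le_div_right (hkin n) _).trans hM))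
            2)).trans (le_of_eq ?_)) _)
      have h5 : (3 + 2 : ℝ≥0∞) = ENNReal.ofReal 5 := by norm_num
      rw [← add_mul, h5, ← ENNReal.ofReal_mul (by norm_num), mul_div_cancel₀ _ (by norm_num),
        ENNReal.ofReal_coe_nnreal]
    -- The localized mass converges, the box having finite volume, and for the limit it is at most
    -- `Tr G`.
    refine (ge_of_tendsto ((tendsto_hsSq_of_hilbertSchmidt hpos hG h hν htr _ ?_).add_const _)
      (Eventually.of_forall hb)).trans (add_le_add_left
        (hsSq_localizationOp_le hG measurableSet_Icc measurableSet_Icc) _)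
    rw [tsum_enorm_localizationOp _ (by simp)]
    simp [ENNReal.mul_eq_top]

/-- If no mass is lost, then the mass of every set converges. -/
theorem tendsto_posMeasure {U : Ultrafilter ℕ} {Gn : ℕ → Op} {G : Op} {ν : ℝ}
    (hGn : ∀ n, Gn n ∈ states ν) (hG : G ∈ states ν) (h : FormTendsto U Gn G) {s : Set ℝ}
    (hs : MeasurableSet s) : Tendsto (fun n => posMeasure (Gn n) s) U (𝓝 (posMeasure G s)) := by
  have hex : ∀ f : ℕ → ℝ≥0∞, ∃ l, Tendsto f U (𝓝 l) := fun f => ⟨_, (U.map f).le_nhds_lim⟩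
  have hle : ∀ {t : Set ℝ} {l}, MeasurableSet t → Tendsto (fun n => posMeasure (Gn n) t) U (𝓝 l) →
      posMeasure G t ≤ l := fun ht hl => by
    simp_rw [posMeasure, massMeasure_apply _ _ ht] at hl ⊢
    exact hsSq_le_of_tendsto (fun n => (hGn n).1) hG.1 h _ hl
  obtain ⟨l, hl⟩ := hex fun n => posMeasure (Gn n) s
  obtain ⟨l', hl'⟩ := hex fun n => posMeasure (Gn n) sᶜ
  have h1 : posMeasure G s + posMeasure G sᶜ = ENNReal.ofReal ν := by
    rw [measure_add_measure_compl hs, posMeasure_univ hG.1, hG.2]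
  have h2 : l + l' = ENNReal.ofReal ν := by
    refine tendsto_nhds_unique (hl.add hl') (tendsto_const_nhds.congr fun n => ?_)
    rw [measure_add_measure_compl hs, posMeasure_univ (hGn n).1, (hGn n).2]
  -- Mass can only drop in the limit on `s` and on its complement; as the totals agree, neither can
  -- drop strictly.
  rcases (hle hs hl).eq_or_lt with h3 | h3
  · rwa [h3]
  · have h4 := ENNReal.add_lt_add_of_lt_of_le (posMeasure_ne_top hG.1
      (hG.2 ▸ ENNReal.ofReal_ne_top) sᶜ) h3 (hle hs.compl hl')
    rw [h1, h2] at h4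
    exact absurd h4 (lt_irrefl _)

end Tightness

/-! ### Existence of a minimizer. -/

section Existence

/-- Monotone functions that converge on `ℚ` to a continuous function converge everywhere. -/
theorem tendsto_of_tendsto_rat {f : ℕ → ℝ → ℝ} {g : ℝ → ℝ} {l : Filter ℕ}
    (hf : ∀ n, Monotone (f n)) (hg : Continuous g)
    (h : ∀ q : ℚ, Tendsto (fun n => f n q) l (𝓝 (g q))) (x : ℝ) :
    Tendsto (fun n => f n x) l (𝓝 (g x)) := by
  rw [tendsto_order]
  constructor
  · intro a ha
    obtain ⟨u, v, hx, huv⟩ := mem_nhds_iff_exists_Ioo_subset.1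
      ((hg.tendsto x).eventually (lt_mem_nhds ha))
    obtain ⟨q, hq, hq'⟩ := exists_rat_btwn hx.1
    filter_upwards [(h q).eventually (lt_mem_nhds (huv ⟨hq, hq'.trans hx.2⟩))] with n hn
    exact hn.trans_le (hf n hq'.le)
  · intro a ha
    obtain ⟨u, v, hx, huv⟩ := mem_nhds_iff_exists_Ioo_subset.1
      ((hg.tendsto x).eventually (gt_mem_nhds ha))
    obtain ⟨q, hq, hq'⟩ := exists_rat_btwn hx.2
    filter_upwards [(h q).eventually (gt_mem_nhds (huv ⟨hx.1.trans hq, hq'⟩))] with n hn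
    exact (hf n hq.le).trans_lt hn

/-- Fatou needs a sequence, not an ultrafilter. The values at rationals together with the integral
form a point of a first countable space, so a subsequence converges there; monotonicity then gives
convergence at every `x`. -/
theorem lintegral_sq_le_of_tendsto {U : Filter ℕ} [U.NeBot] (hU : U ≤ atTop) {f : ℕ → ℝ → ℝ}
    {g m : ℝ → ℝ} (hf : ∀ n, Monotone (f n)) (hg : Continuous g) (hm : Measurable m)
    (h : ∀ x, Tendsto (fun n => f n x) U (𝓝 (g x))) {l : ℝ≥0∞}
    (hl : Tendsto (fun n => ∫⁻ x, ‖f n x - m x‖ₑ ^ 2) U (𝓝 l)) :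
    ∫⁻ x, ‖g x - m x‖ₑ ^ 2 ≤ l := by
  let y : ℕ → (ℚ → ℝ) × ℝ≥0∞ := fun n => (fun q => f n q, ∫⁻ x, ‖f n x - m x‖ₑ ^ 2)
  have hq : Tendsto (fun n => fun q : ℚ => f n q) U (𝓝 fun q => g q) :=
    tendsto_pi_nhds.2 fun q => h q
  have hy : Tendsto y U (𝓝 (fun q => g q, l)) := hq.prodMk_nhds hl
  obtain ⟨ψ, -, hψ⟩ := (hy.mapClusterPt.mono hU).tendsto_subseq
  have h1 : ∀ q : ℚ, Tendsto (fun n => f (ψ n) q) atTop (𝓝 (g q)) := fun q =>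
    (tendsto_pi_nhds.1 ((continuous_fst.tendsto _).comp hψ)) q
  have h2 : Tendsto (fun n => ∫⁻ x, ‖f (ψ n) x - m x‖ₑ ^ 2) atTop (𝓝 l) :=
    (continuous_snd.tendsto _).comp hψ
  have h3 := tendsto_of_tendsto_rat (fun n => hf (ψ n)) hg h1
  have hmeas : ∀ n, Measurable fun x => ‖f (ψ n) x - m x‖ₑ ^ 2 := fun n =>
    (((hf (ψ n)).measurable.sub hm).enorm).pow_const 2
  calc ∫⁻ x, ‖g x - m x‖ₑ ^ 2 = ∫⁻ x, liminf (fun n => ‖f (ψ n) x - m x‖ₑ ^ 2) atTop := by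
        refine lintegral_congr fun x => ((Tendsto.liminf_eq ?_)).symm
        exact (((ENNReal.continuous_pow 2).comp continuous_enorm).tendsto _).comp
          ((h3 x).sub_const (m x))
    _ ≤ liminf (fun n => ∫⁻ x, ‖f (ψ n) x - m x‖ₑ ^ 2) atTop := lintegral_liminf_le hmeas
    _ = l := h2.liminf_eq

theorem exists_isMinimizer {b : ℝ} {μ : ℝ → ℝ} (hμ : Integrable μ) (hμ0 : ∀ᵐ x, 0 ≤ μ x)
    (hI : infEnergy b μ < ∞) : ∃ G, IsMinimizer b μ G := by
  set ν := ∫ x, μ x with hν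
  have hν0 : 0 ≤ ν := integral_nonneg_of_ae hμ0
  have hseq : ∀ n : ℕ, ∃ G ∈ states ν,
      energy b μ G ≤ infEnergy b μ + (n + 1 : ℝ≥0∞)⁻¹ := fun n => by
    have h1 : infEnergy b μ < infEnergy b μ + (n + 1 : ℝ≥0∞)⁻¹ :=
      ENNReal.lt_add_right hI.ne (by simp)
    obtain ⟨G, hG⟩ := iInf_lt_iff.1 h1
    obtain ⟨hG', hG''⟩ := iInf_lt_iff.1 hG
    exact ⟨G, hG', hG''.le⟩
  choose Gn hGn hE using hseq
  have hinf : ∀ G ∈ states ν, infEnergy b μ ≤ energy b μ G := fun G hG => iInf₂_le G hG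
  have hT : ∀ G ∈ states ν, trace G ≠ ∞ := fun G hG => hG.2 ▸ ENNReal.ofReal_ne_top
  -- The factor `2` offsets the `½` in front of the kinetic and Hartree terms.
  set K := 2 * (infEnergy b μ + 1) with hK
  have hKtop : K ≠ ∞ := ENNReal.mul_ne_top (by simp) (ENNReal.add_ne_top.2 ⟨hI.ne, by simp⟩)
  have hEK : ∀ n, 2 * energy b μ (Gn n) ≤ K := fun n => by
    refine mul_le_mul_right ((hE n).trans (add_le_add_right ?_ _)) _
    exact ENNReal.inv_le_one.2 (by simp)
  have hh : ∀ a : ℝ≥0∞, 2 * (2⁻¹ * a) = a := fun a => by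
    rw [← mul_assoc, ENNReal.mul_inv_cancel two_ne_zero ENNReal.ofNat_ne_top, one_mul]
  have hkin : ∀ n, traceLaplace (Gn n) ≤ K := fun n => by
    refine le_trans ?_ (hEK n)
    rw [energy, mul_add, mul_add, hh, add_assoc]
    exact le_self_add
  have hhar : ∀ n, hartree (fun x => density (Gn n) x - μ x) ≤ K := fun n => by
    refine le_trans ?_ (hEK n)
    rw [energy, mul_add, hh]
    exact le_add_self
  -- Along an ultrafilter every sequence in `[0, ∞]` converges, so the three terms have limits
  -- without passing to subsequences.
  let U : Ultrafilter ℕ := hyperfilter ℕ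
  have hU : (U : Filter ℕ) ≤ atTop := Nat.hyperfilter_le_atTop
  have hex : ∀ f : ℕ → ℝ≥0∞, ∃ l, Tendsto f U (𝓝 l) := fun f => ⟨_, (U.map f).le_nhds_lim⟩
  obtain ⟨G, hG, hlim⟩ := exists_weak_limit U (fun n => (hGn n).1)
    (fun n => norm_le_of_trace (hGn n).1 hν0 (hGn n).2)
  have hGs : G ∈ states ν := by
    refine ⟨hG, trace_eq_of_formTendsto hν0 hGn hG hlim hKtop hkin fun ε hε => ?_⟩
    obtain ⟨R, hR⟩ := exists_posMeasure_compl_le hμ hKtop hε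
    exact ⟨R, fun n => hR (Gn n) (hGn n) (hhar n)⟩
  obtain ⟨k, hk⟩ := hex fun n => traceLaplace (Gn n)
  obtain ⟨f, hf⟩ := hex fun n => trace (FOp b (Gn n))
  obtain ⟨d, hd⟩ := hex fun n => ∫⁻ x, ‖distrib (Gn n) x - primitive μ x‖ₑ ^ 2
  have hk' : traceLaplace G ≤ k := by
    simp_rw [traceLaplace_eq_lintegral] at hk ⊢
    exact lintegral_massMeasure_le_of_tendsto (fun n => (hGn n).1) hG hlim _ hex _ hk
  have hf' : trace (FOp b G) ≤ f :=
    trace_FOp_le_of_tendsto (fun n => (hGn n).1) hG (hT G hGs) hlim b hf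
  have hd' : ∫⁻ x, ‖distrib G x - primitive μ x‖ₑ ^ 2 ≤ d := by
    refine lintegral_sq_le_of_tendsto hU (fun n => monotone_distrib (hGn n).1 (hT _ (hGn n)))
      (continuous_distrib hG (hT G hGs)) (continuous_integral_Iic hμ).measurable (fun x => ?_) hd
    exact (ENNReal.tendsto_toReal (posMeasure_ne_top hG (hT G hGs) _)).comp
      (tendsto_posMeasure hGn hGs hlim measurableSet_Iic)
  refine ⟨G, hGs, le_antisymm ?_ (hinf G hGs)⟩
  have hElim : Tendsto (fun n => energy b μ (Gn n)) U
      (𝓝 (2⁻¹ * k + f + 2⁻¹ * (ENNReal.ofReal (4 * Real.pi) * d))) := by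
    simp_rw [energy, hartree_density_sub (hGn _).1 (hT _ (hGn _)) hμ]
    have h2 : (2⁻¹ : ℝ≥0∞) ≠ ∞ := by simp
    exact ((ENNReal.Tendsto.const_mul hk (Or.inr h2)).add hf).add (ENNReal.Tendsto.const_mul
      (ENNReal.Tendsto.const_mul hd (Or.inr ENNReal.ofReal_ne_top)) (Or.inr h2))
  have hIlim : Tendsto (fun n : ℕ => infEnergy b μ + (n + 1 : ℝ≥0∞)⁻¹) U (𝓝 (infEnergy b μ)) := by
    have h3 : Tendsto (fun n : ℕ => ((n + 1 : ℕ) : ℝ≥0∞)⁻¹) atTop (𝓝 0) :=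
      ENNReal.tendsto_inv_nat_nhds_zero.comp (tendsto_add_atTop_nat 1)
    have h4 := (h3.const_add (infEnergy b μ)).mono_left hU
    simpa using h4
  refine le_trans ?_ (le_of_tendsto_of_tendsto' hElim hIlim hE)
  rw [energy, hartree_density_sub hG (hT G hGs) hμ]
  gcongr

end Existence

/-! ### Uniqueness of the density. -/

section Uniqueness

theorem lintegral_parallelogram {u v : ℝ → ℝ} (hu : Measurable u) (hv : Measurable v) :
    (∫⁻ x, ‖2⁻¹ * u x + 2⁻¹ * v x‖ₑ ^ 2) + ∫⁻ x, ‖2⁻¹ * u x - 2⁻¹ * v x‖ₑ ^ 2 =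
      2⁻¹ * (∫⁻ x, ‖u x‖ₑ ^ 2) + 2⁻¹ * ∫⁻ x, ‖v x‖ₑ ^ 2 := by
  rw [← lintegral_const_mul _ (by fun_prop), ← lintegral_const_mul _ (by fun_prop),
    ← lintegral_add_left (by fun_prop), ← lintegral_add_left (by fun_prop)]
  refine lintegral_congr fun x => ?_
  have h2 : (2⁻¹ : ℝ≥0∞) = ENNReal.ofReal 2⁻¹ := by
    rw [ENNReal.ofReal_inv_of_pos two_pos]; simp
  rw [h2]
  simp_rw [← ofReal_norm, ← ENNReal.ofReal_pow (norm_nonneg _), Real.norm_eq_abs, sq_abs]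
  rw [← ENNReal.ofReal_mul (by norm_num), ← ENNReal.ofReal_mul (by norm_num),
    ← ENNReal.ofReal_add (by positivity) (by positivity),
    ← ENNReal.ofReal_add (by positivity) (by positivity)]
  congr 1
  ring

/-- A finite measure is determined by its values on half-lines, and its density almost everywhere by
the measure. -/
theorem density_ae_eq_of_distrib_eq {G₁ G₂ : Op} (h₁ : G₁.IsPositive) (h₂ : G₂.IsPositive)
    (hT₁ : trace G₁ ≠ ∞) (hT₂ : trace G₂ ≠ ∞) (h : distrib G₁ = distrib G₂) :
    ∀ᵐ x, density G₁ x = density G₂ x := by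
  have hfin : IsFiniteMeasure (posMeasure G₁) := ⟨(posMeasure_ne_top h₁ hT₁ _).lt_top⟩
  have h3 : posMeasure G₁ = posMeasure G₂ := Measure.ext_of_Iic _ _ fun x =>
    (ENNReal.toReal_eq_toReal_iff' (posMeasure_ne_top h₁ hT₁ _)
      (posMeasure_ne_top h₂ hT₂ _)).1 (congrFun h x)
  have h4 := (withDensity_eq_iff (aemeasurable_densityIn G₁) (aemeasurable_densityIn G₂)
    (by rwa [lintegral_densityIn basis h₁])).1 h3
  filter_upwards [h4] with x hx
  rw [density, density, hx]

/-- The midpoint of two minimizers would lower the energy by a multiple of the `L²` distance `D` of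
the distribution functions. -/
theorem density_ae_eq_of_isMinimizer {b : ℝ} {μ : ℝ → ℝ} (hμ : Integrable μ)
    (hI : infEnergy b μ < ∞) {G₁ G₂ : Op} (h₁ : IsMinimizer b μ G₁) (h₂ : IsMinimizer b μ G₂) :
    ∀ᵐ x, density G₁ x = density G₂ x := by
  obtain ⟨hs₁, hE₁⟩ := h₁
  obtain ⟨hs₂, hE₂⟩ := h₂
  set ν := ∫ x, μ x with hν
  have hT : ∀ G ∈ states ν, trace G ≠ ∞ := fun G hG => hG.2 ▸ ENNReal.ofReal_ne_top
  have h2 : (2⁻¹ : ℝ≥0∞) = ENNReal.ofReal 2⁻¹ := by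
    rw [ENNReal.ofReal_inv_of_pos two_pos]; simp
  have hhalf : (0 : ℝ) ≤ 2⁻¹ := by norm_num
  let G : Op := ((2⁻¹ : ℝ) : ℂ) • G₁ + ((2⁻¹ : ℝ) : ℂ) • G₂
  have hG : G.IsPositive :=
    (isPositive_real_smul hs₁.1 hhalf).add (isPositive_real_smul hs₂.1 hhalf)
  have hmass : ∀ V, massMeasure V G =
      (2⁻¹ : ℝ≥0∞) • massMeasure V G₁ + (2⁻¹ : ℝ≥0∞) • massMeasure V G₂ := fun V => by
    rw [h2]; exact massMeasure_add_smul V hs₁.1 hs₂.1 hhalf hhalf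
  have hpos : ∀ s, posMeasure G s = 2⁻¹ * posMeasure G₁ s + 2⁻¹ * posMeasure G₂ s := fun s => by
    rw [posMeasure, hmass]; rfl
  have hGs : G ∈ states ν := by
    refine ⟨hG, ?_⟩
    rw [← posMeasure_univ hG, hpos, posMeasure_univ hs₁.1, posMeasure_univ hs₂.1, hs₁.2, hs₂.2,
      ← add_mul, ENNReal.inv_two_add_inv_two, one_mul]
  have hkin : traceLaplace G = 2⁻¹ * traceLaplace G₁ + 2⁻¹ * traceLaplace G₂ := by
    simp_rw [traceLaplace_eq_lintegral]
    rw [hmass, lintegral_add_measure, lintegral_smul_measure, lintegral_smul_measure]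
    rfl
  have hdis : ∀ x, distrib G x - primitive μ x = 2⁻¹ * (distrib G₁ x - primitive μ x) +
      2⁻¹ * (distrib G₂ x - primitive μ x) := fun x => by
    have : distrib G x = 2⁻¹ * distrib G₁ x + 2⁻¹ * distrib G₂ x := by
      rw [distrib, hpos, ENNReal.toReal_add
        (ENNReal.mul_ne_top (by simp) (posMeasure_ne_top hs₁.1 (hT _ hs₁) _))
        (ENNReal.mul_ne_top (by simp) (posMeasure_ne_top hs₂.1 (hT _ hs₂) _))]
      simp [distrib]
    rw [this]; ring
  have hm : ∀ G' ∈ states ν, Measurable fun x => distrib G' x - primitive μ x := fun G' hG' =>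
    ((continuous_distrib hG'.1 (hT _ hG')).sub (continuous_integral_Iic hμ)).measurable
  have hpar := lintegral_parallelogram (hm _ hs₁) (hm _ hs₂)
  simp_rw [← hdis] at hpar
  set D := ∫⁻ x, ‖2⁻¹ * (distrib G₁ x - primitive μ x) -
    2⁻¹ * (distrib G₂ x - primitive μ x)‖ₑ ^ 2 with hD
  have hhar : hartree (fun x => density G x - μ x) + ENNReal.ofReal (4 * Real.pi) * D =
      2⁻¹ * hartree (fun x => density G₁ x - μ x) +
        2⁻¹ * hartree (fun x => density G₂ x - μ x) := by
    rw [hartree_density_sub hG (hT _ hGs) hμ, hartree_density_sub hs₁.1 (hT _ hs₁) hμ,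
      hartree_density_sub hs₂.1 (hT _ hs₂) hμ, ← mul_add, hpar]
    ring
  have hE : energy b μ G + 2⁻¹ * (ENNReal.ofReal (4 * Real.pi) * D) ≤ infEnergy b μ := by
    calc _ = 2⁻¹ * traceLaplace G + trace (FOp b G) + 2⁻¹ * (hartree (fun x => density G x - μ x) +
          ENNReal.ofReal (4 * Real.pi) * D) := by rw [energy]; ring
      _ ≤ 2⁻¹ * traceLaplace G + (2⁻¹ * trace (FOp b G₁) + 2⁻¹ * trace (FOp b G₂)) +
          2⁻¹ * (hartree (fun x => density G x - μ x) + ENNReal.ofReal (4 * Real.pi) * D) := by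
          gcongr
          exact trace_FOp_midpoint_le b hs₁.1 hs₂.1 hG (hT _ hGs) rfl
      _ = 2⁻¹ * energy b μ G₁ + 2⁻¹ * energy b μ G₂ := by
          rw [hkin, hhar, energy, energy]; ring
      _ = infEnergy b μ := by
          rw [hE₁, hE₂, ← add_mul, ENNReal.inv_two_add_inv_two, one_mul]
  have hD0 : D = 0 := by
    have h3 : infEnergy b μ + 2⁻¹ * (ENNReal.ofReal (4 * Real.pi) * D) ≤ infEnergy b μ + 0 := by
      rw [add_zero]
      exact (add_le_add_left (iInf₂_le G hGs) _).trans hE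
    -- Cancellation in `[0, ∞]` is where finiteness of the infimum is needed.
    have h4 := (ENNReal.add_le_add_iff_left hI.ne).1 h3
    simpa [Real.pi_pos.not_ge] using h4
  have hae : distrib G₁ =ᵐ[volume] distrib G₂ := by
    have hm₁ := hm _ hs₁
    have hm₂ := hm _ hs₂
    rw [hD, lintegral_eq_zero_iff (by fun_prop)] at hD0
    filter_upwards [hD0] with x hx
    have h5 : 2⁻¹ * (distrib G₁ x - primitive μ x) - 2⁻¹ * (distrib G₂ x - primitive μ x) = 0 := by
      simpa using hx
    linarith
  -- Continuity upgrades almost everywhere equality of the distribution functions to equality at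
  -- every point.
  exact density_ae_eq_of_distrib_eq hs₁.1 hs₂.1 (hT _ hs₁) (hT _ hs₂)
    ((Continuous.ae_eq_iff_eq volume (continuous_distrib hs₁.1 (hT _ hs₁))
      (continuous_distrib hs₂.1 (hT _ hs₂))).1 hae)

end Uniqueness

/-! ### Mixtures of rank one projections. -/

section Superposition

variable {H : Type*} [NormedAddCommGroup H] [InnerProductSpace ℂ H] [CompleteSpace H]

/-- The operator `∑ₖ mₖ |φₖ⟩⟨φₖ|`. -/
def superposition (m : ℤ → ℝ) (φ : ℤ → H) : H →L[ℂ] H :=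
  ∑' k, (m k : ℂ) • InnerProductSpace.rankOne ℂ (φ k) (φ k)

/-- The series defining the operator converges in norm because its terms have norm `m k`;
orthogonality of the `φ k` plays no role. -/
theorem hasSum_inner_superposition {m : ℤ → ℝ} (hm0 : ∀ k, 0 ≤ m k) (hm : Summable m) {φ : ℤ → H}
    (hφ : ∀ k, ‖φ k‖ = 1) (u : H) :
    HasSum (fun k => m k * ‖inner ℂ (φ k) u‖ ^ 2) (RCLike.re (inner ℂ u (superposition m φ u))) ∧
      (superposition m φ).IsPositive := by
  have hs : Summable fun k => (m k : ℂ) • InnerProductSpace.rankOne ℂ (φ k) (φ k) := by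
    refine Summable.of_norm_bounded hm fun k => ?_
    rw [norm_smul, InnerProductSpace.norm_rankOne, hφ, mul_one, mul_one, Complex.norm_real,
      Real.norm_of_nonneg (hm0 k)]
  have h1 : ∀ u, HasSum (fun k => ((m k * ‖inner ℂ (φ k) u‖ ^ 2 : ℝ) : ℂ))
      (inner ℂ u (superposition m φ u)) := fun u => by
    have h2 := hs.hasSum.mapL ((innerSL ℂ u).comp (ContinuousLinearMap.apply ℂ H u))
    refine h2.congr_fun fun k => ?_
    simp only [ContinuousLinearMap.comp_apply, ContinuousLinearMap.apply_apply, innerSL_apply_apply,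
      FunLike.coe_smul, Pi.smul_apply, InnerProductSpace.rankOne_apply, inner_smul_right]
    rw [← inner_conj_symm u (φ k), Complex.mul_conj']
    push_cast
    ring
  have h3 : ∀ u, HasSum (fun k => m k * ‖inner ℂ (φ k) u‖ ^ 2)
      (RCLike.re (inner ℂ u (superposition m φ u))) := fun u => by
    exact (Complex.hasSum_re (h1 u)).congr_fun fun k => (Complex.ofReal_re _).symm
  refine ⟨h3 u, ?_⟩
  rw [ContinuousLinearMap.isPositive_iff_complex]
  intro v
  have h4 := (h1 v).unique (Complex.hasSum_ofReal.2 (h3 v))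
  refine ⟨?_, ?_⟩
  · rw [← inner_conj_symm, h4, Complex.conj_ofReal]
    simp
  · rw [inner_re_symm]
    exact (h3 v).nonneg fun k => mul_nonneg (hm0 k) (sq_nonneg _)

end Superposition

/-! ### A trial state of finite energy. -/

section TrialState

variable {K : Type*} [NormedAddCommGroup K] [InnerProductSpace ℂ K] [CompleteSpace K]

theorem superposition_isPositive {m : ℤ → ℝ} (hm0 : ∀ k, 0 ≤ m k) (hm : Summable m)
    {φ : ℤ → L2} (hφ : ∀ k, ‖φ k‖ = 1) : (superposition m φ).IsPositive :=
  (hasSum_inner_superposition hm0 hm hφ 0).2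

/-- Since `hsSq` depends only on the quadratic form, the square root of the mixture need not be
computed. -/
theorem hsSq_superposition {m : ℤ → ℝ} (hm0 : ∀ k, 0 ≤ m k) (hm : Summable m) {φ : ℤ → L2}
    (hφ : ∀ k, ‖φ k‖ = 1) (C : L2 →L[ℂ] K) :
    hsSq C (superposition m φ) = ∑' k, ENNReal.ofReal (m k) * ‖C (φ k)‖ₑ ^ 2 := by
  obtain ⟨w, f, -⟩ := exists_hilbertBasis ℂ K
  rw [hsSq_eq_tsum f C (superposition_isPositive hm0 hm hφ)]
  calc _ = ∑' j, ∑' k, ENNReal.ofReal (m k) * ‖inner ℂ (f j) (C (φ k))‖ₑ ^ 2 := by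
        refine tsum_congr fun j => ?_
        have h := (hasSum_inner_superposition hm0 hm hφ (ContinuousLinearMap.adjoint C (f j))).1
        rw [← h.tsum_eq, ENNReal.ofReal_tsum_of_nonneg
          (fun k => mul_nonneg (hm0 k) (sq_nonneg _)) h.summable]
        refine tsum_congr fun k => ?_
        rw [ENNReal.ofReal_mul (hm0 k), ENNReal.ofReal_pow (norm_nonneg _), ofReal_norm,
          ContinuousLinearMap.adjoint_inner_right, ← inner_conj_symm, ← ofReal_norm, ← ofReal_norm,
          RCLike.norm_conj]
    _ = _ := by
        rw [ENNReal.tsum_comm]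
        exact tsum_congr fun k => by rw [ENNReal.tsum_mul_left, ← parseval]

theorem massMeasure_superposition {m : ℤ → ℝ} (hm0 : ∀ k, 0 ≤ m k) (hm : Summable m)
    {φ : ℤ → L2} (hφ : ∀ k, ‖φ k‖ = 1) (V : Op) :
    massMeasure V (superposition m φ) = Measure.sum fun k =>
      ENNReal.ofReal (m k) • volume.withDensity fun x => ‖(V (φ k) : L2) x‖ₑ ^ 2 := by
  ext s hs
  rw [massMeasure_apply V _ hs, hsSq_superposition hm0 hm hφ, Measure.sum_apply _ hs]
  refine tsum_congr fun k => ?_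
  rw [Measure.smul_apply, withDensity_apply _ hs, ContinuousLinearMap.comp_apply,
    enorm_restrict_sq, smul_eq_mul]

theorem traceLaplace_superposition {m : ℤ → ℝ} (hm0 : ∀ k, 0 ≤ m k) (hm : Summable m)
    {φ : ℤ → L2} (hφ : ∀ k, ‖φ k‖ = 1) :
    traceLaplace (superposition m φ) = ∑' k, ENNReal.ofReal (m k) * laplaceForm (φ k) := by
  rw [traceLaplace_eq_lintegral, massMeasure_superposition hm0 hm hφ, lintegral_sum_measure]
  refine tsum_congr fun k => ?_
  rw [lintegral_smul_measure, lintegral_withDensity_eq_lintegral_mul₀ (aemeasurable_enorm_sq _)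
    (by fun_prop), smul_eq_mul, laplaceForm]
  refine congrArg _ (lintegral_congr fun ξ => ?_)
  rw [Pi.mul_apply, mul_comm]
  rfl

/-- Plancherel applied to `f'`, whose Fourier transform is `2πiξ` times that of `f`. -/
theorem laplaceForm_toLp {f : ℝ → ℂ} (hf : ContDiff ℝ 1 f) (hc : HasCompactSupport f) :
    laplaceForm ((hf.continuous.memLp_of_hasCompactSupport (p := 2) (μ := volume) hc).toLp f) =
      ∫⁻ x, ‖deriv f x‖ₑ ^ 2 := by
  have hf2 := hf.continuous.memLp_of_hasCompactSupport (p := 2) (μ := volume) hc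
  have hd := hf.continuous_deriv le_rfl
  have hd2 := hd.memLp_of_hasCompactSupport (p := 2) (μ := volume) hc.deriv
  have hfi : Integrable f := hf.continuous.integrable_of_hasCompactSupport hc
  have hdi : Integrable (deriv f) := hd.integrable_of_hasCompactSupport hc.deriv
  have h1 := fourierOp_coe_ae_eq (hf2.toLp f) ((integrable_congr hf2.coeFn_toLp).2 hfi)
  have h2 := fourierOp_coe_ae_eq (hd2.toLp _) ((integrable_congr hd2.coeFn_toLp).2 hdi)
  have h3 := Real.fourier_deriv hfi (hf.differentiable one_ne_zero) hdi
  have h4 : ∫⁻ x, ‖deriv f x‖ₑ ^ 2 = ‖hd2.toLp _‖ₑ ^ 2 := by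
    rw [enorm_sq_eq_lintegral]
    refine lintegral_congr_ae ?_
    filter_upwards [hd2.coeFn_toLp] with x hx
    rw [hx]
  rw [h4, ← enorm_fourierOp, enorm_sq_eq_lintegral, laplaceForm]
  refine lintegral_congr_ae ?_
  filter_upwards [h1, h2] with ξ h5 h6
  change ENNReal.ofReal _ * ‖(fourierOp (hf2.toLp f) : L2) ξ‖ₑ ^ 2 = _
  rw [h5, h6, Real.fourier_congr_ae hf2.coeFn_toLp, Real.fourier_congr_ae hd2.coeFn_toLp, h3]
  rw [enorm_smul, mul_pow ‖_‖ₑ]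
  refine congrArg (· * ‖𝓕 f ξ‖ₑ ^ 2) ?_
  rw [← ofReal_norm, ← ENNReal.ofReal_pow (norm_nonneg _)]
  simp [mul_pow]

theorem exists_bump : ∃ f : ℝ → ℂ, ContDiff ℝ 1 f ∧ HasCompactSupport f ∧
    (∀ x ∉ Set.Ioo (0 : ℝ) 1, f x = 0) ∧ ∫⁻ x, ‖f x‖ₑ ^ 2 = 1 := by
  let g : ContDiffBump (1 / 2 : ℝ) := ⟨1 / 8, 1 / 4, by norm_num, by norm_num⟩
  have hg1 : ContDiff ℝ 1 g := g.contDiff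
  have hg2 : MemLp g 2 := hg1.continuous.memLp_of_hasCompactSupport g.hasCompactSupport
  have hI : 0 < ∫ x, g x ^ 2 := by
    refine (hg1.continuous.pow 2).integral_pos_of_hasCompactSupport_nonneg_nonzero ?_
      (fun x => sq_nonneg _) (x := 1 / 2) ?_
    · exact g.hasCompactSupport.comp_left (g := fun y : ℝ => y ^ 2) (by simp)
    · have : g (1 / 2) = 1 := g.one_of_mem_closedBall (Metric.mem_closedBall_self g.rIn_pos.le)
      rw [this]; norm_num
  set N := ∫ x, g x ^ 2
  refine ⟨fun x => (((Real.sqrt N)⁻¹ * g x : ℝ) : ℂ), ?_, ?_, ?_, ?_⟩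
  · exact Complex.ofRealCLM.contDiff.comp (contDiff_const.mul hg1)
  · exact g.hasCompactSupport.comp_left (g := fun y : ℝ => (((Real.sqrt N)⁻¹ * y : ℝ) : ℂ))
      (by simp)
  · intro x hx
    have : g x = 0 := g.zero_of_le_dist (by
      rw [Real.dist_eq]
      change (1 / 4 : ℝ) ≤ _
      by_contra! h
      rw [abs_lt] at h
      exact hx ⟨by linarith [h.1], by linarith [h.2]⟩)
    simp [this]
  · have h1 : ∀ x, ‖(((Real.sqrt N)⁻¹ * g x : ℝ) : ℂ)‖ₑ ^ 2 = ENNReal.ofReal (N⁻¹ * g x ^ 2) :=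
      fun x => by
        rw [← ofReal_norm, ← ENNReal.ofReal_pow (norm_nonneg _), Complex.norm_real,
          Real.norm_eq_abs, sq_abs, mul_pow, inv_pow, Real.sq_sqrt hI.le]
    simp_rw [h1]
    rw [← ofReal_integral_eq_lintegral_ofReal (hg2.integrable_sq.const_mul _)
      (Eventually.of_forall fun x => by positivity), integral_const_mul,
      inv_mul_cancel₀ hI.ne', ENNReal.ofReal_one]

/-- There is an orthonormal sequence in `H¹(ℝ)` with uniformly bounded kinetic energy, whose `k`-th
member is supported in `(k, k + 1]`. -/
theorem exists_translates : ∃ (φ : ℤ → L2) (C : ℝ≥0∞), C ≠ ∞ ∧ (∀ k, ‖φ k‖ = 1) ∧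
    (∀ k, laplaceForm (φ k) = C) ∧ ∀ k (n : ℤ), ∫⁻ x in Set.Iic (n : ℝ), ‖φ k x‖ₑ ^ 2 =
      if k < n then 1 else 0 := by
  obtain ⟨f, hf, hc, hsupp, hnorm⟩ := exists_bump
  have hf' : ∀ k : ℤ, ContDiff ℝ 1 fun x => f (x - k) := fun k =>
    hf.comp (contDiff_id.sub contDiff_const)
  have hc' : ∀ k : ℤ, HasCompactSupport fun x => f (x - k) := fun k =>
    hc.comp_homeomorph (Homeomorph.subRight (k : ℝ))
  have hm : ∀ k : ℤ, MemLp (fun x => f (x - k)) 2 := fun k : ℤ =>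
    (hf' k).continuous.memLp_of_hasCompactSupport (hc' k)
  have hd := hf.continuous_deriv le_rfl
  have hint : ∀ (k : ℤ) (s : Set ℝ), ∫⁻ x in s, ‖((hm k).toLp _ : L2) x‖ₑ ^ 2 =
      ∫⁻ x in s, ‖f (x - k)‖ₑ ^ 2 := fun k s => by
    refine lintegral_congr_ae (ae_restrict_of_ae ?_)
    filter_upwards [(hm k).coeFn_toLp] with x hx
    rw [hx]
  have hone : ∀ k : ℤ, ∫⁻ x, ‖f (x - k)‖ₑ ^ 2 = 1 := fun k => by
    rw [lintegral_sub_right_eq_self (fun x => ‖f x‖ₑ ^ 2), hnorm]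
  refine ⟨fun k => (hm k).toLp _, ∫⁻ x, ‖deriv f x‖ₑ ^ 2, ?_, fun k => ?_, fun k => ?_,
    fun k n => ?_⟩
  · have hd2 := hd.memLp_of_hasCompactSupport (p := 2) (μ := volume) hc.deriv
    have h4 : ∫⁻ x, ‖deriv f x‖ₑ ^ 2 = ‖hd2.toLp _‖ₑ ^ 2 := by
      rw [enorm_sq_eq_lintegral]
      refine lintegral_congr_ae ?_
      filter_upwards [hd2.coeFn_toLp] with x hx
      rw [hx]
    rw [h4]
    exact ENNReal.pow_ne_top enorm_ne_top
  · have h := enorm_sq_eq_lintegral ((hm k).toLp _)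
    rw [← setLIntegral_univ, hint, setLIntegral_univ, hone, ← ofReal_norm,
      ← ENNReal.ofReal_pow (norm_nonneg _), ENNReal.ofReal_eq_one] at h
    exact (pow_eq_one_iff_of_nonneg (norm_nonneg _) two_ne_zero).1 h
  · rw [laplaceForm_toLp (hf' k) (hc' k)]
    simp_rw [deriv_comp_sub_const]
    exact lintegral_sub_right_eq_self (fun x => ‖deriv f x‖ₑ ^ 2) _
  · rw [hint]
    split_ifs with h
    · have h' : (k : ℝ) + 1 ≤ n := by exact_mod_cast h
      rw [← hone k, ← lintegral_indicator measurableSet_Iic]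
      refine lintegral_congr fun x => ?_
      by_cases hx : x ∈ Set.Iic (n : ℝ)
      · rw [Set.indicator_of_mem hx]
      · have : f (x - k) = 0 := hsupp _ fun h2 => hx (Set.mem_Iic.2 (by linarith [h2.2]))
        simp [this]
    · have h' : (n : ℝ) ≤ k := by exact_mod_cast not_lt.1 h
      rw [setLIntegral_congr_fun (g := fun _ => 0) measurableSet_Iic, lintegral_zero]
      intro x hx
      have : f (x - k) = 0 := hsupp _ fun h2 => by linarith [h2.1, Set.mem_Iic.1 hx]
      simp [this]

/-- The mixture gives the cell `(k, k + 1]` the mass `m k` that `μ` has there, so both distribution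
functions agree at the integers and their difference is square integrable. -/
theorem infEnergy_lt_top (b : ℝ) {μ : ℝ → ℝ} (hμ : Integrable μ) (hμ0 : ∀ᵐ x, 0 ≤ μ x) :
    infEnergy b μ < ∞ := by
  obtain ⟨φ, C, hC, hφ, hlap, hmass⟩ := exists_translates
  set ν := ∫ x, μ x with hν
  have hν0 : 0 ≤ ν := integral_nonneg_of_ae hμ0
  let m : ℤ → ℝ := fun k => ∫ x in Set.Ioc (k : ℝ) (k + 1), μ x
  have hm0 : ∀ k, 0 ≤ m k := fun k => setIntegral_nonneg_of_ae hμ0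
  have hdisj : Pairwise (Function.onFun Disjoint fun k : ℤ => Set.Ioc (k : ℝ) (k + 1)) :=
    Set.pairwise_disjoint_Ioc_intCast ℝ
  have hsumν : HasSum m ν := by
    have h := hasSum_integral_iUnion (fun k : ℤ => measurableSet_Ioc) hdisj hμ.integrableOn
    rwa [iUnion_Ioc_intCast, setIntegral_univ] at h
  have hsum : ∀ n : ℤ, HasSum (fun k => if k < n then m k else 0) (primitive μ n) := fun n => by
    have h := hasSum_integral_iUnion (s := fun k : ℤ => Set.Ioc (k : ℝ) (k + 1) ∩ Set.Iic (n : ℝ))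
      (fun k => measurableSet_Ioc.inter measurableSet_Iic)
      (fun k l hkl => (hdisj hkl).mono Set.inter_subset_left Set.inter_subset_left)
      (f := μ) (μ := volume) hμ.integrableOn
    rw [← Set.iUnion_inter, iUnion_Ioc_intCast, Set.univ_inter] at h
    refine h.congr_fun fun k => ?_
    split_ifs with hk
    · have h' : (k : ℝ) + 1 ≤ n := by exact_mod_cast hk
      rw [Set.inter_eq_left.2 fun x hx => Set.mem_Iic.2 (hx.2.trans h')]
    · have h' : (n : ℝ) ≤ k := by exact_mod_cast not_lt.1 hk
      have he : Set.Ioc (k : ℝ) (k + 1) ∩ Set.Iic (n : ℝ) = ∅ :=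
        Set.eq_empty_of_forall_notMem fun x hx => by
          linarith [hx.1.1, Set.mem_Iic.1 hx.2]
      rw [he, setIntegral_empty]
  have hs := hsumν.summable
  have hsumE : ∑' k, ENNReal.ofReal (m k) = ENNReal.ofReal ν := by
    rw [← ENNReal.ofReal_tsum_of_nonneg hm0 hs, hsumν.tsum_eq]
  let G : Op := superposition m φ
  have hG : G.IsPositive := superposition_isPositive hm0 hs hφ
  have htr : trace G = ENNReal.ofReal ν := by
    rw [trace_eq_hsSq hG, hsSq_superposition hm0 hs hφ, ← hsumE]
    refine tsum_congr fun k => ?_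
    rw [ContinuousLinearMap.id_apply, ← ofReal_norm, hφ]
    simp
  have hT : trace G ≠ ∞ := htr ▸ ENNReal.ofReal_ne_top
  have hdist : ∀ n : ℤ, distrib G n = primitive μ n := fun n => by
    rw [distrib, posMeasure, massMeasure_apply _ _ measurableSet_Iic,
      hsSq_superposition hm0 hs hφ]
    have h : ∀ k, ENNReal.ofReal (m k) * ‖(LpToLpRestrictCLM ℝ ℂ ℂ volume 2 (Set.Iic (n : ℝ)) ∘L
        ContinuousLinearMap.id ℂ L2) (φ k)‖ₑ ^ 2 = ENNReal.ofReal (if k < n then m k else 0) :=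
      fun k => by
        rw [ContinuousLinearMap.comp_apply, ContinuousLinearMap.id_apply, enorm_restrict_sq, hmass]
        split_ifs <;> simp
    have h0 : ∀ k, 0 ≤ if k < n then m k else 0 := fun k => by
      split_ifs
      exacts [hm0 k, le_rfl]
    simp_rw [h]
    rw [← ENNReal.ofReal_tsum_of_nonneg h0 (hsum n).summable, (hsum n).tsum_eq]
    exact ENNReal.toReal_ofReal (setIntegral_nonneg_of_ae hμ0)
  have hkin : traceLaplace G < ∞ := by
    rw [traceLaplace_superposition hm0 hs hφ]
    simp_rw [hlap]
    rw [ENNReal.tsum_mul_right, hsumE]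
    exact ENNReal.mul_lt_top ENNReal.ofReal_lt_top hC.lt_top
  have hhar : hartree (fun x => density G x - μ x) < ∞ := by
    rw [hartree_density_sub hG hT hμ]
    refine ENNReal.mul_lt_top ENNReal.ofReal_lt_top ?_
    have hstep : ∀ k : ℤ, primitive μ (k + 1) - primitive μ k = m k := fun k => by
      rw [primitive, primitive, intervalIntegral.integral_Iic_sub_Iic hμ.integrableOn
        hμ.integrableOn, intervalIntegral.integral_of_le (by linarith)]
    -- Two monotone functions that agree at both ends of the cell differ by at most their increment
    -- `m k`; from `m k ≤ ν` the square is at most `ν m k`, and the sum over `k` is `ν²`.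
    have hbound : ∀ k : ℤ, ∫⁻ x in Set.Ioc (k : ℝ) (k + 1), ‖distrib G x - primitive μ x‖ₑ ^ 2 ≤
        ENNReal.ofReal ν * ENNReal.ofReal (m k) := fun k => by
      calc _ ≤ ∫⁻ x in Set.Ioc (k : ℝ) (k + 1), ENNReal.ofReal ν * ENNReal.ofReal (m k) := by
            refine setLIntegral_mono' measurableSet_Ioc fun x hx => ?_
            have h1 := monotone_distrib hG hT hx.1.le
            have h2 := monotone_distrib hG hT hx.2
            have h3 := monotone_primitive hμ hμ0 hx.1.le
            have h4 := monotone_primitive hμ hμ0 hx.2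
            have h5 := hdist k
            have h6 := hdist (k + 1)
            push_cast at h6
            have h7 : |distrib G x - primitive μ x| ≤ m k := by
              rw [abs_le, ← hstep k]
              constructor <;> linarith
            have h8 : m k ≤ ν := setIntegral_le_integral hμ hμ0
            rw [← ofReal_norm, Real.norm_eq_abs, sq, ← ENNReal.ofReal_mul (abs_nonneg _),
              ← ENNReal.ofReal_mul hν0]
            exact ENNReal.ofReal_le_ofReal (mul_le_mul (h7.trans h8) h7 (abs_nonneg _) hν0)
        _ = _ := by simp
    rw [← setLIntegral_univ, ← iUnion_Ioc_intCast ℝ, lintegral_iUnion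
      (fun k => measurableSet_Ioc) hdisj]
    refine (ENNReal.tsum_le_tsum hbound).trans_lt ?_
    rw [ENNReal.tsum_mul_left, hsumE]
    exact ENNReal.mul_lt_top ENNReal.ofReal_lt_top ENNReal.ofReal_lt_top
  refine (iInf₂_le G ⟨hG, htr⟩).trans_lt ?_
  rw [energy]
  have h2 : (2⁻¹ : ℝ≥0∞) < ∞ := by simp
  exact ENNReal.add_lt_top.2 ⟨ENNReal.add_lt_top.2 ⟨ENNReal.mul_lt_top h2 hkin,
    trace_FOp_lt_top b hG hν0 htr⟩, ENNReal.mul_lt_top h2 hhar⟩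

end TrialState

end RHF

end

theorem mainTheorem5 (b : ℝ) (μ : ℝ → ℝ) (hμ_int : MeasureTheory.Integrable μ)
    (hμ_nonneg : ∀ᵐ x, 0 ≤ μ x) :
    RHF.infEnergy b μ < ⊤ ∧
      (∃ G : RHF.Op, RHF.IsMinimizer b μ G) ∧
      ∀ G₁ G₂ : RHF.Op, RHF.IsMinimizer b μ G₁ → RHF.IsMinimizer b μ G₂ →
        ∀ᵐ x, RHF.density G₁ x = RHF.density G₂ x := by
  have hI := RHF.infEnergy_lt_top b hμ_int hμ_nonneg
  exact ⟨hI, RHF.exists_isMinimizer hμ_int hμ_nonneg hI,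
    fun _ _ h₁ h₂ => RHF.density_ae_eq_of_isMinimizer hμ_int hI h₁ h₂⟩
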